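/- **Theorem 2.2.** For real $\Delta<-1$ let $\Theta_\Delta:\mathbb R^2\to\mathbb R$ be the unique continuous function with $\Theta_\Delta(0,0)=0$ and $$e^{-i\Theta_\Delta(x,y)}=e^{i(x-y)}\,\frac{e^{-ix}+e^{iy}-2\Delta}{e^{ix}+e^{-iy}-2\Delta};$$ let $\lambda>0$ satisfy $\cosh\lambda=-\Delta$; let $k=k_\Delta:[-\pi,\pi]\to[-\pi,\pi]$ be the unique continuous function with $k(\pm\pi)=\pm\pi$ and $e^{ik(\alpha)}=\frac{e^\lambda-e^{-i\alpha}}{e^{\lambda-i\alpha}-1}$ (it is a bijection); and define $\rho=\rho_\Delta$ on $[-\pi,\pi]$ by $$\rho(k(\alpha))=\frac1{4\lambda k'(\alpha)}\sum_{j\in\mathbb Z}\frac1{\cosh[\pi(2\pi j+\alpha)/(2\lambda)]}.$$ For $\Delta=-\infty$ put $\Theta_{-\infty}(x,y)=y-x$, $k(\alpha)=\alpha$ and $\rho=\frac1{4\pi}$. For $f:[-\pi,\pi]\to\mathbb R$ let $\|f\|=\|f\|_\Delta:=\sup_{\alpha\in[-\pi,\pi]}|k'(\alpha)f(k(\alpha))|$.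 For integers $N,n$ set $I_j=j-\frac{n+1}2$ for $1\le j\le n$, $I_0=I_n-(N-n)$ and $I_{n+1}=I_1+(N-n)$. The Bethe equations with parameters $\Delta,N,n$ are $$Np_j=2\pi I_j-\sum_{k=1}^n\Theta_\Delta(p_j,p_k),\qquad 1\le j\le n.$$ Let $\mathcal S_n$ be the set of $\mathbf p=(p_1,\dots,p_n)$ with $-\pi<p_1<\dots<p_n<\pi$ and $p_{n+1-j}=-p_j$ for all $j$. For $\mathbf p\in\mathcal S_n$ put $p_0=p_n-2\pi$, $p_{n+1}=p_1+2\pi$, and let $\rho_{\mathbf p}$ be the step function on $[-\pi,\pi]$ equal to $\frac{I_{j+1}-I_j}{N(p_{j+1}-p_j)}$ on $[p_j,p_{j+1})$, $0\le j\le n$. Fix an integer $r\ge0$ and a real number $\Delta_0<-1$. Then there exist $K>0$ and $N_0$ such that for every even integer $N\ge N_0$, with $n=N/2-r$, there is a family $(\mathbf p_\Delta)_{-\infty\le\Delta\le\Delta_0}$ in $\mathcal S_n$ such that $\mathbf p_\Delta$ solves the Bethe equations with parameters $\Delta,N,n$ for every $\Delta\in[-\infty,\Delta_0]$ and (i) $\Delta\mapsto\mathbf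 p_\Delta$ is analytic on $[-\infty,\Delta_0)$, where analyticity at $-\infty$ means that there are $a_0,a_1,\ldots\in\mathbb R^n$ with $\mathbf p_\Delta=\sum_{m\ge0}a_m\Delta^{-m}$ for all real $\Delta$ sufficiently close to $-\infty$, and $\mathbf p_{-\infty}=a_0$; (ii) $\|\rho_{\mathbf p_\Delta}-\rho_\Delta\|_\Delta\le K/N$ for all $\Delta\in[-\infty,\Delta_0]$. -/

import Mathlib

namespace BetheEq

open Set

/-! The anisotropy parameter `Δ` ranges over `[-∞, ∞)`, modelled by `WithBot ℝ` with `⊥ = -∞`.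
Only the values `Δ < -1` (including `-∞`) are meaningful below. -/

/-- The function `Θ_Δ(x, y)`.  For real `Δ < -1` it is the unique continuous function with
`Θ(0,0) = 0` and
`exp(-i Θ(x,y)) = e^{i(x-y)} (e^{-ix} + e^{iy} - 2Δ) / (e^{ix} + e^{-iy} - 2Δ)`
(see `theta_continuous`, `theta_zero`, `exp_theta`, `theta_unique`);
for `Δ = -∞` it is `y - x`. -/
noncomputable def theta : WithBot ℝ → ℝ → ℝ → ℝ
  | ⊥, x, y => y - x
  | (Δ : ℝ), x, y =>
      y - x + 2 * Real.arctan ((Real.sin x - Real.sin y) / (Real.cos x + Real.cos y - 2 * Δ))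

/-- The number `λ > 0` with `cosh λ = -Δ`, for real `Δ < -1`. -/
noncomputable def lam (Δ : ℝ) : ℝ := Real.arcosh (-Δ)

/-- The change of variables `k_Δ`.  For real `Δ < -1` its restriction to `[-π, π]` is the unique
continuous function with `k(±π) = ±π` and
`e^{i k(α)} = (e^λ - e^{-iα}) / (e^{λ - iα} - 1)`
(see `kMap_continuous`, `kMap_pi`, `kMap_neg_pi`, `exp_kMap`, `kMap_unique`), and it is a bijection
of `[-π, π]` (see `kMap_bijOn`).  For `Δ = -∞` it is the identity. -/
noncomputable def kMap : WithBot ℝ → ℝ → ℝ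
  | ⊥, α => α
  | (Δ : ℝ), α =>
      α + 2 * Real.arctan (Real.sin α / (Real.exp (lam Δ) - Real.cos α))

/-- The inverse of `k_Δ : [-π, π] → [-π, π]`. -/
noncomputable def kInv (Δ : WithBot ℝ) : ℝ → ℝ :=
  Function.invFunOn (kMap Δ) (Icc (-Real.pi) Real.pi)

/-- The density `ρ_Δ` on `[-π, π]`: with `x = k(α)`,
`ρ(x) = (4 λ k'(α))⁻¹ ∑_{j ∈ ℤ} 1 / cosh(π (2πj + α) / (2λ))`; the series
converges absolutely.  For `Δ = -∞` it is the constant `1 / (4π)`. -/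
noncomputable def rho : WithBot ℝ → ℝ → ℝ
  | ⊥, _ => 1 / (4 * Real.pi)
  | (Δ : ℝ), x =>
      1 / (4 * lam Δ * deriv (kMap Δ) (kInv Δ x)) *
        ∑' j : ℤ, 1 / Real.cosh
          (Real.pi * (2 * Real.pi * (j : ℝ) + kInv Δ x) / (2 * lam Δ))

/-- The weighted sup norm `‖f‖ = sup {|k'(α) f(k(α))| : α ∈ [-π, π]}`, with values in `[0, ∞]`
so that it is `∞` for an unbounded `f`. -/
noncomputable def wNorm (Δ : WithBot ℝ) (f : ℝ → ℝ) : ENNReal :=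
  ⨆ α ∈ Icc (-Real.pi) Real.pi, ENNReal.ofReal |deriv (kMap Δ) α * f (kMap Δ α)|

/-- `I_j = j - (n+1)/2` for `1 ≤ j ≤ n`, extended by `I_0 = I_n - (N - n)` and
`I_{n+1} = I_1 + (N - n)`. -/
noncomputable def qI (N n j : ℕ) : ℝ :=
  if j = 0 then ((n : ℝ) - ((n : ℝ) + 1) / 2) - ((N : ℝ) - n)
  else if j = n + 1 then ((1 : ℝ) - ((n : ℝ) + 1) / 2) + ((N : ℝ) - n)
  else (j : ℝ) - ((n : ℝ) + 1) / 2

/-- The coordinate `p_j` of `p = (p_1, …, p_n)`, with the index `1 ≤ j ≤ n` counted from `1`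
(and the value `0` for other indices, which is never used). -/
noncomputable def coord {n : ℕ} (p : Fin n → ℝ) (j : ℕ) : ℝ :=
  if h : 1 ≤ j ∧ j ≤ n then p ⟨j - 1, by omega⟩ else 0

/-- The coordinates `p_1, …, p_n` extended by `p_0 = p_n - 2π` and `p_{n+1} = p_1 + 2π`. -/
noncomputable def extCoord {n : ℕ} (p : Fin n → ℝ) (j : ℕ) : ℝ :=
  if j = 0 then coord p n - 2 * Real.pi
  else if j = n + 1 then coord p 1 + 2 * Real.pi
  else coord p j

/-- The set `S_n` of the `(p_1, …, p_n)` with `-π < p_1 < ⋯ < p_n < π` and `p_{n+1-j} = -p_j`. -/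
def symSet (n : ℕ) : Set (Fin n → ℝ) :=
  {p | (∀ j, -Real.pi < p j ∧ p j < Real.pi) ∧ StrictMono p ∧ ∀ j, p (Fin.rev j) = -p j}

/-- The Bethe equations `N p_j = 2π I_j - ∑_{k=1}^n Θ_Δ(p_j, p_k)` for `1 ≤ j ≤ n`, with
`I_j = j - (n+1)/2`; the index `j : Fin n` stands for `j + 1`. -/
def IsBetheSolution (Δ : WithBot ℝ) (N : ℕ) {n : ℕ} (p : Fin n → ℝ) : Prop :=
  ∀ j : Fin n, (N : ℝ) * p j =
    2 * Real.pi * qI N n ((j : ℕ) + 1) - ∑ k : Fin n, theta Δ (p j) (p k)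

/-- The step function `ρ_p`, equal to `(I_{j+1} - I_j) / (N (p_{j+1} - p_j))` on
`[p_j, p_{j+1})`, for `0 ≤ j ≤ n`. -/
noncomputable def stepRho (N : ℕ) {n : ℕ} (p : Fin n → ℝ) (t : ℝ) : ℝ :=
  ∑ j ∈ Finset.range (n + 1),
    (Ico (extCoord p j) (extCoord p (j + 1))).indicator
      (fun _ => (qI N n (j + 1) - qI N n j) / ((N : ℝ) * (extCoord p (j + 1) - extCoord p j))) t

/-- Analyticity at `-∞`: there are coefficients `a_m` with `f(x) = ∑_{m ≥ 0} a_m x^{-m}` for every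
real `x` close enough to `-∞` and also for `x = -∞`, where the series reduces to `a_0`. -/
def AnalyticAtNegInfty {n : ℕ} (f : WithBot ℝ → Fin n → ℝ) : Prop :=
  ∃ a : ℕ → Fin n → ℝ, f ⊥ = a 0 ∧
    ∃ M : ℝ, M < 0 ∧ ∀ x : ℝ, x ≤ M → HasSum (fun m : ℕ => (x⁻¹) ^ m • a m) (f (x : WithBot ℝ))

/-! Facts showing that `lam`, `theta` and `kMap` are the intended objects. -/

theorem lam_pos {Δ : ℝ} (h : Δ < -1) : 0 < lam Δ := Real.arcosh_pos (by linarith)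

theorem cosh_lam {Δ : ℝ} (h : Δ < -1) : Real.cosh (lam Δ) = -Δ :=
  Real.cosh_arcosh (by linarith)

/-- Two continuous lifts of the same circle-valued function that agree at a point are equal. -/
theorem lift_unique {X : Type*} [TopologicalSpace X] [PreconnectedSpace X] {f g : X → ℝ}
    (hf : Continuous f) (hg : Continuous g) (x₀ : X) (h₀ : f x₀ = g x₀)
    (h : ∀ x, Complex.exp (Complex.I * f x) = Complex.exp (Complex.I * g x)) : f = g := by
  have hs : ∀ x, ∃ m : ℤ, f x - g x = m * (2 * Real.pi) := by
    intro x
    obtain ⟨m, hm⟩ := Complex.exp_eq_exp_iff_exists_int.1 (h x)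
    refine ⟨m, ?_⟩
    have := congrArg Complex.im hm
    simp at this
    linarith
  have hpi := Real.pi_pos
  have hcl : IsClopen {x | f x = g x} := by
    refine ⟨isClosed_eq hf hg, ?_⟩
    have : {x | f x = g x} = {x | |f x - g x| < 2 * Real.pi} := by
      ext x
      simp only [mem_ofPred_eq]
      constructor
      · intro hx
        rw [hx]; simp; positivity
      · intro hx
        obtain ⟨m, hm⟩ := hs x
        rw [hm, abs_mul, abs_of_pos (by positivity : 0 < 2 * Real.pi)] at hx
        have h1 : |(m : ℝ)| < 1 := by
          by_contra hc
          push Not at hc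
          nlinarith
        have h2 : m = 0 := by
          rw [← Int.abs_lt_one_iff]
          exact_mod_cast h1
        rw [h2] at hm
        simp at hm
        linarith
    rw [this]
    exact isOpen_lt (by fun_prop) continuous_const
  have := hcl.eq_univ ⟨x₀, h₀⟩
  funext x
  have hx : x ∈ {x | f x = g x} := this ▸ mem_univ x
  exact hx

theorem theta_denom_pos {Δ : ℝ} (h : Δ < -1) (x y : ℝ) :
    0 < Real.cos x + Real.cos y - 2 * Δ := by
  have := Real.neg_one_le_cos x
  have := Real.neg_one_le_cos y
  linarith

theorem theta_continuous {Δ : ℝ} (h : Δ < -1) :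
    Continuous (fun z : ℝ × ℝ => theta Δ z.1 z.2) := by
  have h0 : ∀ z : ℝ × ℝ, Real.cos z.1 + Real.cos z.2 - 2 * Δ ≠ 0 :=
    fun z => (theta_denom_pos h z.1 z.2).ne'
  show Continuous (fun z : ℝ × ℝ => z.2 - z.1 + 2 * Real.arctan
    ((Real.sin z.1 - Real.sin z.2) / (Real.cos z.1 + Real.cos z.2 - 2 * Δ)))
  have h1 : Continuous (fun z : ℝ × ℝ =>
      (Real.sin z.1 - Real.sin z.2) / (Real.cos z.1 + Real.cos z.2 - 2 * Δ)) :=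
    Continuous.div (by fun_prop) (by fun_prop) h0
  have h2 := Real.continuous_arctan.comp h1
  exact (continuous_snd.sub continuous_fst).add (continuous_const.mul h2)

theorem theta_zero (Δ : ℝ) : theta Δ 0 0 = 0 := by
  show (0 : ℝ) - 0 + 2 * Real.arctan
    ((Real.sin 0 - Real.sin 0) / (Real.cos 0 + Real.cos 0 - 2 * Δ)) = 0
  simp

/-- For `a > 0`: `e^{2 i arctan(b/a)} = (a + ib) / (a - ib)`. -/
theorem exp_two_arctan {a : ℝ} (ha : 0 < a) (b : ℝ) :
    Complex.exp (Complex.I * ((2 * Real.arctan (b / a) : ℝ) : ℂ)) =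
      ((a : ℂ) + Complex.I * b) / ((a : ℂ) - Complex.I * b) := by
  have hz : ((a : ℂ) - Complex.I * b) ≠ 0 := by
    intro h
    have := congrArg Complex.re h
    simp at this
    linarith
  set t := Real.arctan (b / a) with ht
  have hc : Real.cos t ≠ 0 := (Real.cos_arctan_pos _).ne'
  have hb : b * Real.cos t = a * Real.sin t := by
    have h1 : Real.tan t = b / a := Real.tan_arctan _
    rw [Real.tan_eq_sin_div_cos, div_eq_div_iff hc ha.ne'] at h1
    linarith
  have hbC : (b : ℂ) * Complex.cos t = a * Complex.sin t := by exact_mod_cast hb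
  have hcC : Complex.cos t ≠ 0 := by exact_mod_cast hc
  have hsc := Complex.sin_sq_add_cos_sq (t : ℂ)
  rw [eq_div_iff hz]
  have e1 : Complex.exp (Complex.I * ((2 * t : ℝ) : ℂ)) =
      (Complex.cos t + Complex.sin t * Complex.I) ^ 2 := by
    rw [← Complex.exp_mul_I, ← Complex.exp_nat_mul]
    congr 1
    push_cast
    ring
  rw [e1]
  have hI := Complex.I_sq
  apply mul_right_cancel₀ hcC
  linear_combination
    (-Complex.I * (Complex.cos t + Complex.sin t * Complex.I) ^ 2 - Complex.I) * hbC +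
    ((a : ℂ) * (Complex.cos t + Complex.sin t * Complex.I)) * hsc +
    (-(a : ℂ) * Complex.sin t ^ 2 * (Complex.cos t + Complex.sin t * Complex.I)) * hI

theorem exp_theta {Δ : ℝ} (h : Δ < -1) (x y : ℝ) :
    Complex.exp (-(Complex.I * (theta Δ x y : ℂ))) =
      Complex.exp (Complex.I * ((x : ℂ) - y)) *
        ((Complex.exp (-(Complex.I * x)) + Complex.exp (Complex.I * y) - 2 * Δ) /
          (Complex.exp (Complex.I * x) + Complex.exp (-(Complex.I * y)) - 2 * Δ)) := by
  have key := exp_two_arctan (theta_denom_pos h x y) (Real.sin y - Real.sin x)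
  have hth : theta Δ x y = y - x - 2 * Real.arctan
      ((Real.sin y - Real.sin x) / (Real.cos x + Real.cos y - 2 * Δ)) := by
    show y - x + 2 * Real.arctan
      ((Real.sin x - Real.sin y) / (Real.cos x + Real.cos y - 2 * Δ)) = _
    rw [← neg_sub (Real.sin y), neg_div, Real.arctan_neg]
    ring
  rw [hth]
  have : -(Complex.I * ((y - x - 2 * Real.arctan
      ((Real.sin y - Real.sin x) / (Real.cos x + Real.cos y - 2 * Δ)) : ℝ) : ℂ)) =
      Complex.I * ((x : ℂ) - y) + Complex.I * ((2 * Real.arctan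
      ((Real.sin y - Real.sin x) / (Real.cos x + Real.cos y - 2 * Δ)) : ℝ) : ℂ) := by
    push_cast; ring
  rw [this, Complex.exp_add, key]
  have ex : ∀ u : ℝ, Complex.exp (Complex.I * u) = Real.cos u + Complex.I * Real.sin u := by
    intro u
    rw [mul_comm, Complex.exp_mul_I]; push_cast; ring
  have ex' : ∀ u : ℝ, Complex.exp (-(Complex.I * u)) = Real.cos u - Complex.I * Real.sin u := by
    intro u
    have := ex (-u)
    rw [Real.cos_neg, Real.sin_neg] at this
    push_cast at this ⊢
    rw [mul_neg] at this
    rw [this]; ring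
  rw [ex x, ex' x, ex y, ex' y]
  congr 2 <;> (push_cast; ring)

theorem theta_unique {Δ : ℝ} (h : Δ < -1) (f : ℝ × ℝ → ℝ) (hf : Continuous f)
    (h0 : f (0, 0) = 0)
    (he : ∀ x y : ℝ, Complex.exp (-(Complex.I * (f (x, y) : ℂ))) =
      Complex.exp (Complex.I * ((x : ℂ) - y)) *
        ((Complex.exp (-(Complex.I * x)) + Complex.exp (Complex.I * y) - 2 * Δ) /
          (Complex.exp (Complex.I * x) + Complex.exp (-(Complex.I * y)) - 2 * Δ))) :
    f = fun z => theta Δ z.1 z.2 := by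
  refine lift_unique hf (theta_continuous h) (0, 0) (by rw [h0]; exact (theta_zero Δ).symm) ?_
  rintro ⟨x, y⟩
  have := (he x y).trans (exp_theta h x y).symm
  rw [Complex.exp_neg, Complex.exp_neg] at this
  exact inv_injective this

theorem k_denom_pos {Δ : ℝ} (h : Δ < -1) (α : ℝ) :
    0 < Real.exp (lam Δ) - Real.cos α := by
  have := Real.cos_le_one α
  have := Real.one_lt_exp_iff.2 (lam_pos h)
  linarith

theorem hasDerivAt_kMap {Δ : ℝ} (h : Δ < -1) (α : ℝ) :
    HasDerivAt (kMap Δ) (Real.sinh (lam Δ) / (Real.cosh (lam Δ) - Real.cos α)) α := by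
  have hd := k_denom_pos h α
  have h1 : HasDerivAt (fun α => Real.sin α / (Real.exp (lam Δ) - Real.cos α))
      ((Real.cos α * (Real.exp (lam Δ) - Real.cos α) - Real.sin α * (0 - -Real.sin α)) /
        (Real.exp (lam Δ) - Real.cos α) ^ 2) α :=
    (Real.hasDerivAt_sin α).div ((hasDerivAt_const α _).sub (Real.hasDerivAt_cos α)) hd.ne'
  have h2 := (hasDerivAt_id α).add (h1.arctan.const_mul 2)
  refine h2.congr_deriv ?_
  have hl := lam_pos h
  have hE : 1 < Real.exp (lam Δ) := Real.one_lt_exp_iff.2 hl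
  rw [Real.sinh_eq, Real.cosh_eq, Real.exp_neg]
  set E := Real.exp (lam Δ)
  have hE0 : E ≠ 0 := by positivity
  have hsc := Real.sin_sq_add_cos_sq α
  have hc1 := Real.cos_le_one α
  have e1 : (E + E⁻¹) / 2 - Real.cos α ≠ 0 := by
    have h3 : 0 < (E - 1) ^ 2 := by nlinarith
    have h4 : (E + E⁻¹) / 2 - Real.cos α = ((E - 1) ^ 2 + 2 * E * (1 - Real.cos α)) / (2 * E) := by
      field_simp; ring
    rw [h4]
    have : 0 ≤ 2 * E * (1 - Real.cos α) := by
      apply mul_nonneg <;> nlinarith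
    positivity
  have e2 : 1 + (Real.sin α / (E - Real.cos α)) ^ 2 ≠ 0 := by positivity
  have e3 : (E - Real.cos α) ^ 2 + Real.sin α ^ 2 ≠ 0 := by positivity
  have e4 : E ^ 2 + 1 - 2 * E * Real.cos α ≠ 0 := by
    have : E ^ 2 + 1 - 2 * E * Real.cos α = (E - Real.cos α) ^ 2 + Real.sin α ^ 2 := by
      linear_combination -hsc
    rw [this]; exact e3
  have hdn := hd.ne'
  have lhs : 1 + 2 * (1 / (1 + (Real.sin α / (E - Real.cos α)) ^ 2) *
      ((Real.cos α * (E - Real.cos α) - Real.sin α * (0 - -Real.sin α)) /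
        (E - Real.cos α) ^ 2)) = (E ^ 2 - 1) / ((E - Real.cos α) ^ 2 + Real.sin α ^ 2) := by
    have e5 : 1 + (Real.sin α / (E - Real.cos α)) ^ 2 =
        ((E - Real.cos α) ^ 2 + Real.sin α ^ 2) / (E - Real.cos α) ^ 2 := by
      field_simp
    rw [e5, one_div_div, div_mul_div_cancel₀' (pow_ne_zero 2 hdn), eq_div_iff e3, add_mul,
      mul_assoc, div_mul_cancel₀ _ e3]
    linear_combination (-1 : ℝ) * hsc
  have rhs : (E - E⁻¹) / 2 / ((E + E⁻¹) / 2 - Real.cos α) =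
      (E ^ 2 - 1) / ((E - Real.cos α) ^ 2 + Real.sin α ^ 2) := by
    rw [div_eq_div_iff e1 e3]
    field_simp
    linear_combination (E ^ 2 - 1) * hsc
  rw [rhs]
  exact lhs

theorem kMap_continuous {Δ : ℝ} (h : Δ < -1) : Continuous (kMap Δ) :=
  continuous_iff_continuousAt.2 fun α => (hasDerivAt_kMap h α).continuousAt

theorem kMap_pi (Δ : ℝ) : kMap Δ Real.pi = Real.pi := by
  show Real.pi + 2 * Real.arctan (Real.sin Real.pi / _) = _
  simp

theorem kMap_neg_pi (Δ : ℝ) : kMap Δ (-Real.pi) = -Real.pi := by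
  show -Real.pi + 2 * Real.arctan (Real.sin (-Real.pi) / _) = _
  simp

theorem exp_kMap {Δ : ℝ} (h : Δ < -1) (α : ℝ) :
    Complex.exp (Complex.I * (kMap Δ α : ℂ)) =
      (Complex.exp (lam Δ) - Complex.exp (-(Complex.I * α))) /
        (Complex.exp (lam Δ - Complex.I * α) - 1) := by
  have hd := k_denom_pos h α
  have key := exp_two_arctan hd (Real.sin α)
  have hk : kMap Δ α = α + 2 * Real.arctan (Real.sin α / (Real.exp (lam Δ) - Real.cos α)) := rfl
  have ex : Complex.exp (-(Complex.I * α)) = Real.cos α - Complex.I * Real.sin α := by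
    have := Complex.exp_mul_I (-(α : ℂ))
    rw [Complex.cos_neg, Complex.sin_neg] at this
    push_cast
    rw [show -(Complex.I * (α : ℂ)) = -(α : ℂ) * Complex.I by ring, this]; ring
  have hne := Complex.exp_ne_zero (Complex.I * α)
  have hmul : Complex.exp (-(Complex.I * α)) * Complex.exp (Complex.I * α) = 1 := by
    rw [← Complex.exp_add]; simp
  have ex' : Complex.exp (Complex.I * α) = Real.cos α + Complex.I * Real.sin α := by
    rw [mul_comm, Complex.exp_mul_I]; push_cast; ring
  rw [hk, Complex.ofReal_add, mul_add, Complex.exp_add, key, sub_eq_add_neg (lam Δ : ℂ),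
    Complex.exp_add]
  set a : ℂ := Complex.exp (Complex.I * α)
  set b : ℂ := Complex.exp (-(Complex.I * α))
  have n1 : ((Real.exp (lam Δ) - Real.cos α : ℝ) : ℂ) + Complex.I * Real.sin α =
      Complex.exp (lam Δ) - b := by
    rw [ex]; push_cast; ring
  have n2 : ((Real.exp (lam Δ) - Real.cos α : ℝ) : ℂ) - Complex.I * Real.sin α =
      Complex.exp (lam Δ) - a := by
    rw [ex']; push_cast; ring
  rw [n1, n2]
  have n3 : Complex.exp (lam Δ) * b - 1 = b * (Complex.exp (lam Δ) - a) := by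
    linear_combination hmul
  have hb : b ≠ 0 := Complex.exp_ne_zero _
  rw [n3, ← mul_div_assoc, ← mul_div_mul_left _ _ hb, ← mul_assoc, hmul, one_mul]

theorem kMap_unique {Δ : ℝ} (h : Δ < -1) (f : Icc (-Real.pi) Real.pi → ℝ) (hf : Continuous f)
    (hpi : f ⟨Real.pi, by constructor <;> linarith [Real.pi_pos]⟩ = Real.pi)
    (he : ∀ α : Icc (-Real.pi) Real.pi, Complex.exp (Complex.I * (f α : ℂ)) =
      (Complex.exp (lam Δ) - Complex.exp (-(Complex.I * (α : ℝ)))) /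
        (Complex.exp (lam Δ - Complex.I * (α : ℝ)) - 1)) :
    f = fun α : Icc (-Real.pi) Real.pi => kMap Δ α := by
  have : PreconnectedSpace (Icc (-Real.pi) Real.pi) := Subtype.preconnectedSpace isPreconnected_Icc
  exact lift_unique hf ((kMap_continuous h).comp continuous_subtype_val) _
    (hpi.trans (kMap_pi Δ).symm) (fun α => (he α).trans (exp_kMap h α).symm)

theorem kMap_strictMono {Δ : ℝ} (h : Δ < -1) : StrictMono (kMap Δ) := by
  refine strictMono_of_deriv_pos fun α => ?_
  rw [(hasDerivAt_kMap h α).deriv]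
  have hl := lam_pos h
  have h1 : 1 < Real.cosh (lam Δ) := Real.one_lt_cosh.2 hl.ne'
  have h2 := Real.cos_le_one α
  exact div_pos (Real.sinh_pos_iff.2 hl) (by linarith)

theorem kMap_bijOn {Δ : ℝ} (h : Δ < -1) :
    BijOn (kMap Δ) (Icc (-Real.pi) Real.pi) (Icc (-Real.pi) Real.pi) := by
  have hm := kMap_strictMono h
  refine ⟨fun α hα => ?_, hm.injective.injOn, ?_⟩
  · have h1 := hm.monotone hα.1
    have h2 := hm.monotone hα.2
    rw [kMap_neg_pi] at h1
    rw [kMap_pi] at h2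
    exact ⟨h1, h2⟩
  · have := intermediate_value_Icc (f := kMap Δ) (by linarith [Real.pi_pos] : -Real.pi ≤ Real.pi)
      (kMap_continuous h).continuousOn
    rwa [kMap_neg_pi, kMap_pi] at this

end BetheEq

/-!
Put `t = e^{-λ}` for real `Δ` and `t = 0` for `Δ = -∞`, so that `t` is analytic in `1/Δ` near
`1/Δ = 0` and `Δ ≤ Δ₀` becomes `0 ≤ t ≤ t₀ < 1`.  In the variables `p_j = k(x_j)` one has
`k = phase t` and `Θ(k(α), k(β)) = -phase (t²) (α - β)` (`theta_kMap`), where the derivative of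
`phase s` is the Poisson kernel `poisson s`.  The Bethe equations say that the counting function
`Z(α) = N phase t α - ∑_k phase (t²) (α - x_k)` takes the value `2π I_j` at `x_j`.

*The limiting density.*  In the variable `α` the density `ρ_Δ` becomes `dens t`, which has Fourier
coefficients `1 / (4π cosh (λm))`.  It is given as a sum of hyperbolic secants, and Poisson
summation (`dens_exp_neg`) passes from one expression to the other: the secants show that `dens` is
positive, hence bounded below uniformly in `t`, while the Fourier series gives regularity and the
integral equation `poisson t = 2π dens t + poisson (t²) * dens t`
(`poisson_eq_dens_add_integral`), where `*` is convolution over a period.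

*Existence.*  Let `a_j` be the quantiles of `dens t` at the heights `I_j / N`.  Sums of Lipschitz
functions over the `a_j` agree with `N` times the integral against `dens t` up to `O(1)`
(`abs_integral_sub_sum_node_le`), so that by the integral equation the `a_j` solve the equations up
to `O(1)` in each coordinate.  On the Euclidean ball of radius `R / √N` about `a` the slope `Z'` is
still `2πN dens + O(1)`, since there `∑_k |x_k - a_k| ≤ R`; hence `Z' ≥ cN`.  The derivative of the
Bethe map is the diagonal matrix of the `Z'(x_j)` plus the matrix `poisson (t²) (x_j - x_k)`, which
is positive semidefinite, so that the map is strongly monotone with constant `cN` on this ball.  As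
its value at the centre has Euclidean norm `O(√N)`, it has exactly one zero in the ball once `R` is
large (`exists_zero_of_strongly_monotone`).  Uniqueness gives the symmetry `x_{n+1-j} = -x_j` and,
with the analytic implicit function theorem, the analyticity in `t` (`exists_solution_family`).

*Density.*  By the mean value theorem each value of the step function is
`Z'(ξ) / (2πN k'(η))` with `ξ`, `η` in a step of length `O(1/N)`, and `Z' = 2πN dens + O(1)`
(`abs_mul_stepRho_sub_dens_le`).
-/

namespace BetheEq

open Set Filter Topology MeasureTheory
open scoped Real ContDiff FourierTransform InnerProductSpace

/-! ### The phase functions and the Poisson kernel -/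

/-- The increasing lift of the Blaschke factor `z ↦ (z - s) / (1 - s z)` of the unit circle: by
`exp_phase`, `e^{i phase s α} = (e^{iα} - s) / (1 - s e^{iα})` for `|s| < 1`. -/
noncomputable def phase (s α : ℝ) : ℝ :=
  α + 2 * Real.arctan (s * Real.sin α / (1 - s * Real.cos α))

/-- The Poisson kernel of the unit disc at radius `s` and angle `α`, not divided by `2π`. -/
noncomputable def poisson (s α : ℝ) : ℝ :=
  (1 - s ^ 2) / (1 - 2 * s * Real.cos α + s ^ 2)

/-- The parameter `t = e^{-λ}`, equal to `0` at `Δ = -∞`. -/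
noncomputable def nome : WithBot ℝ → ℝ
  | ⊥ => 0
  | (Δ : ℝ) => Real.exp (-lam Δ)

theorem mul_cos_lt_one {s : ℝ} (hs : |s| < 1) (α : ℝ) : s * Real.cos α < 1 := by
  have h1 : |s * Real.cos α| ≤ |s| := by
    rw [abs_mul]
    exact mul_le_of_le_one_right (abs_nonneg _) (Real.abs_cos_le_one α)
  linarith [le_abs_self (s * Real.cos α)]

theorem poisson_denom_pos {s : ℝ} (hs : |s| < 1) (α : ℝ) :
    0 < 1 - 2 * s * Real.cos α + s ^ 2 := by
  have h1 := mul_cos_lt_one hs α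
  have h2 : 1 - 2 * s * Real.cos α + s ^ 2 =
      (1 - s * Real.cos α) ^ 2 + (s * Real.sin α) ^ 2 := by
    linear_combination (-s ^ 2) * Real.sin_sq_add_cos_sq α
  rw [h2]
  have : 0 < 1 - s * Real.cos α := by linarith
  positivity

theorem sq_lt_one_of_abs_lt {s : ℝ} (hs : |s| < 1) : s ^ 2 < 1 := by
  rw [← sq_abs]; nlinarith [abs_nonneg s]

theorem exp_I_mul (u : ℝ) :
    Complex.exp (Complex.I * u) = Real.cos u + Complex.I * Real.sin u := by
  rw [mul_comm, Complex.exp_mul_I]; push_cast; ring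

theorem one_sub_mul_exp_ne_zero {s : ℝ} (hs : |s| < 1) (α : ℝ) :
    1 - (s : ℂ) * Complex.exp (Complex.I * α) ≠ 0 := by
  intro h
  have := congrArg Complex.re h
  rw [exp_I_mul] at this
  simp [-Complex.ofReal_cos, -Complex.ofReal_sin] at this
  have h1 := mul_cos_lt_one hs α
  linarith

theorem exp_phase {s : ℝ} (hs : |s| < 1) (α : ℝ) :
    Complex.exp (Complex.I * (phase s α : ℂ)) =
      (Complex.exp (Complex.I * α) - s) / (1 - s * Complex.exp (Complex.I * α)) := by
  have ha : 0 < 1 - s * Real.cos α := by linarith [mul_cos_lt_one hs α]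
  have key := exp_two_arctan ha (s * Real.sin α)
  have hne := one_sub_mul_exp_ne_zero hs α
  rw [phase, Complex.ofReal_add, mul_add, Complex.exp_add, key]
  have n2 : ((1 - s * Real.cos α : ℝ) : ℂ) - Complex.I * (s * Real.sin α : ℝ) =
      1 - s * Complex.exp (Complex.I * α) := by
    rw [exp_I_mul]; push_cast; ring
  rw [n2, ← mul_div_assoc]
  congr 1
  rw [exp_I_mul]
  push_cast
  have hsc := Complex.sin_sq_add_cos_sq (α : ℂ)
  linear_combination (-(s : ℂ)) * hsc + s * Complex.sin α ^ 2 * Complex.I_sq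

theorem hasDerivAt_phase {s : ℝ} (hs : |s| < 1) (α : ℝ) :
    HasDerivAt (phase s) (poisson s α) α := by
  have hd : 0 < 1 - s * Real.cos α := by linarith [mul_cos_lt_one hs α]
  have hp := poisson_denom_pos hs α
  have h1 : HasDerivAt (fun α => s * Real.sin α / (1 - s * Real.cos α))
      ((s * Real.cos α * (1 - s * Real.cos α) - s * Real.sin α * (0 - s * -Real.sin α)) /
        (1 - s * Real.cos α) ^ 2) α :=
    ((Real.hasDerivAt_sin α).const_mul s).div
      ((hasDerivAt_const α _).sub ((Real.hasDerivAt_cos α).const_mul s)) hd.ne'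
  have h2 := (hasDerivAt_id α).add (h1.arctan.const_mul 2)
  refine h2.congr_deriv ?_
  have hsc := Real.sin_sq_add_cos_sq α
  have e5 : 1 + (s * Real.sin α / (1 - s * Real.cos α)) ^ 2 =
      (1 - 2 * s * Real.cos α + s ^ 2) / (1 - s * Real.cos α) ^ 2 := by
    field_simp
    linear_combination s ^ 2 * hsc
  rw [e5, one_div_div, div_mul_div_cancel₀' (pow_ne_zero 2 hd.ne'), poisson, eq_div_iff hp.ne',
    add_mul, mul_assoc 2 (_ / _), div_mul_cancel₀ _ hp.ne']
  linear_combination (-2 * s ^ 2) * hsc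

theorem continuous_phase {s : ℝ} (hs : |s| < 1) : Continuous (phase s) :=
  continuous_iff_continuousAt.2 fun α => (hasDerivAt_phase hs α).continuousAt

theorem phase_neg (s α : ℝ) : phase s (-α) = -phase s α := by
  simp only [phase, Real.sin_neg, Real.cos_neg, mul_neg, neg_div, Real.arctan_neg]; ring

theorem phase_zero_right (s : ℝ) : phase s 0 = 0 := by simp [phase]

theorem phase_zero_left (α : ℝ) : phase 0 α = α := by simp [phase]

theorem phase_add_two_pi (s α : ℝ) : phase s (α + 2 * π) = phase s α + 2 * π := by
  simp only [phase, Real.sin_add_two_pi, Real.cos_add_two_pi]; ring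

theorem phase_pi (s : ℝ) : phase s π = π := by simp [phase]

theorem poisson_pos {s : ℝ} (hs : |s| < 1) (α : ℝ) : 0 < poisson s α :=
  div_pos (by linarith [sq_lt_one_of_abs_lt hs]) (poisson_denom_pos hs α)

theorem phase_strictMono {s : ℝ} (hs : |s| < 1) : StrictMono (phase s) :=
  strictMono_of_deriv_pos fun α => by
    rw [(hasDerivAt_phase hs α).deriv]; exact poisson_pos hs α

theorem continuous_poisson {s : ℝ} (hs : |s| < 1) : Continuous (poisson s) :=
  Continuous.div (by fun_prop) (by fun_prop) fun α => (poisson_denom_pos hs α).ne'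

/-! ### Uniform bounds on the Poisson kernel -/

theorem sq_one_sub_le_poisson_denom {s t₀ : ℝ} (h0 : 0 ≤ s) (h1 : s ≤ t₀) (ht : t₀ < 1) (α : ℝ) :
    (1 - t₀) ^ 2 ≤ 1 - 2 * s * Real.cos α + s ^ 2 := by
  nlinarith [Real.cos_le_one α, mul_nonneg h0 (sub_nonneg.2 (Real.cos_le_one α))]

theorem poisson_le {s t₀ : ℝ} (h0 : 0 ≤ s) (h1 : s ≤ t₀) (ht : t₀ < 1) (α : ℝ) :
    poisson s α ≤ 1 / (1 - t₀) ^ 2 := by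
  have h2 := sq_one_sub_le_poisson_denom h0 h1 ht α
  have h3 : 0 < (1 - t₀) ^ 2 := by have : 0 < 1 - t₀ := by linarith
                                   positivity
  exact div_le_div₀ zero_le_one (by nlinarith) h3 h2

theorem le_poisson {s t₀ : ℝ} (h0 : 0 ≤ s) (h1 : s ≤ t₀) (ht : t₀ < 1) (α : ℝ) :
    (1 - t₀) / 4 ≤ poisson s α := by
  have hp := poisson_denom_pos (s := s) (by rw [abs_of_nonneg h0]; linarith) α
  rw [poisson, le_div_iff₀ hp]
  have h4 : 1 - 2 * s * Real.cos α + s ^ 2 ≤ 4 := by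
    nlinarith [Real.neg_one_le_cos α, mul_nonneg h0 (by linarith [Real.neg_one_le_cos α] :
      0 ≤ 1 + Real.cos α)]
  have h5 : (1 - t₀) / 4 * (1 - 2 * s * Real.cos α + s ^ 2) ≤ (1 - t₀) / 4 * 4 :=
    mul_le_mul_of_nonneg_left h4 (by linarith)
  nlinarith

theorem abs_cos_sub_cos_le (α β : ℝ) : |Real.cos α - Real.cos β| ≤ |α - β| := by
  have := Convex.norm_image_sub_le_of_norm_deriv_le (f := Real.cos) (s := univ) (C := 1)
    (fun x _ => Real.differentiable_cos x)
    (fun x _ => by simpa using Real.abs_sin_le_one x) convex_univ (mem_univ β) (mem_univ α)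
  simpa using this

theorem abs_poisson_sub_le {s t₀ : ℝ} (h0 : 0 ≤ s) (h1 : s ≤ t₀) (ht : t₀ < 1) (α β : ℝ) :
    |poisson s α - poisson s β| ≤ 2 / (1 - t₀) ^ 4 * |α - β| := by
  have hs : |s| < 1 := by rw [abs_of_nonneg h0]; linarith
  have hp := poisson_denom_pos hs α
  have hq := poisson_denom_pos hs β
  have h2 := sq_one_sub_le_poisson_denom h0 h1 ht α
  have h3 := sq_one_sub_le_poisson_denom h0 h1 ht β
  have h4 : 0 < (1 - t₀) ^ 2 := by have : 0 < 1 - t₀ := by linarith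
                                   positivity
  have e : poisson s α - poisson s β = (2 * s * (1 - s ^ 2) * (Real.cos α - Real.cos β)) /
      ((1 - 2 * s * Real.cos α + s ^ 2) * (1 - 2 * s * Real.cos β + s ^ 2)) := by
    rw [poisson, poisson, div_sub_div _ _ hp.ne' hq.ne']; congr 1; ring
  rw [e, abs_div, abs_mul, abs_of_pos (mul_pos hp hq), div_mul_eq_mul_div]
  have h5 : |2 * s * (1 - s ^ 2)| ≤ 2 := by
    have h9 := sq_lt_one_of_abs_lt hs
    rw [abs_of_nonneg (mul_nonneg (by linarith) (by linarith))]
    nlinarith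
  refine div_le_div₀ (by positivity) ?_ (by positivity) ?_
  · exact mul_le_mul h5 (abs_cos_sub_cos_le α β) (abs_nonneg _) (by norm_num)
  · calc (1 - t₀) ^ 4 = (1 - t₀) ^ 2 * (1 - t₀) ^ 2 := by ring
      _ ≤ _ := mul_le_mul h2 h3 h4.le hp.le

/-! ### The Poisson kernel: Fourier series and positive semidefiniteness -/

theorem hasSum_poisson {s : ℝ} (hs : |s| < 1) (α : ℝ) :
    HasSum (fun m : ℕ => 2 * (s ^ (m + 1) * Real.cos ((m + 1 : ℕ) * α))) (poisson s α - 1) := by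
  set z : ℂ := s * Complex.exp (Complex.I * α) with hz
  have hnorm : ‖z‖ < 1 := by
    rw [hz, norm_mul, mul_comm Complex.I, Complex.norm_exp_ofReal_mul_I]
    simpa using hs
  have h1 : HasSum (fun m : ℕ => 2 * z ^ (m + 1)) (2 * (z * (1 - z)⁻¹)) := by
    have := ((hasSum_geometric_of_norm_lt_one hnorm).mul_left z).mul_left 2
    simpa only [pow_succ'] using this
  have h2 := Complex.hasSum_re h1
  convert! h2 using 1
  · funext m
    rw [hz, mul_pow, ← Complex.exp_nat_mul]
    have : ((m + 1 : ℕ) : ℂ) * (Complex.I * α) = Complex.I * (((m + 1 : ℕ) * α : ℝ) : ℂ) := by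
      push_cast; ring
    rw [this, exp_I_mul, ← Complex.ofReal_pow]
    simp [-Complex.ofReal_cos, -Complex.ofReal_sin, -Complex.ofReal_pow]
  · have hp := poisson_denom_pos hs α
    have hw : 1 - z ≠ 0 := one_sub_mul_exp_ne_zero hs α
    have h3 : z * (1 - z)⁻¹ = (1 - z)⁻¹ - 1 := by field_simp; ring
    have h4 : (1 - z).re = 1 - s * Real.cos α := by
      simp [hz, exp_I_mul, -Complex.ofReal_cos, -Complex.ofReal_sin]
    have h5 : Complex.normSq (1 - z) = 1 - 2 * s * Real.cos α + s ^ 2 := by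
      rw [Complex.normSq_apply, h4]
      have : (1 - z).im = -(s * Real.sin α) := by
        simp [hz, exp_I_mul, -Complex.ofReal_cos, -Complex.ofReal_sin]
      rw [this]
      linear_combination s ^ 2 * Real.sin_sq_add_cos_sq α
    have h6 : ((1 - z)⁻¹).re = (1 - s * Real.cos α) / (1 - 2 * s * Real.cos α + s ^ 2) := by
      rw [Complex.inv_re, h4, h5]
    have h7 : (2 * ((1 - z)⁻¹ - 1)).re = 2 * (((1 - z)⁻¹).re - 1) := by simp
    rw [h3, h7, h6, poisson, div_sub_one hp.ne', div_sub_one hp.ne']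
    ring

/-- The kernel `poisson s (x - y)` is positive semidefinite, because its Fourier coefficients `s^|m|`
are nonnegative. -/
theorem poisson_posSemidef {s : ℝ} (h0 : 0 ≤ s) (h1 : s < 1) {ι : Type*} (F : Finset ι)
    (x d : ι → ℝ) : 0 ≤ ∑ j ∈ F, ∑ k ∈ F, poisson s (x j - x k) * (d j * d k) := by
  have hs : |s| < 1 := by rwa [abs_of_nonneg h0]
  have h2 : HasSum (fun m : ℕ => ∑ j ∈ F, ∑ k ∈ F,
      2 * (s ^ (m + 1) * Real.cos ((m + 1 : ℕ) * (x j - x k))) * (d j * d k))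
      (∑ j ∈ F, ∑ k ∈ F, (poisson s (x j - x k) - 1) * (d j * d k)) :=
    hasSum_sum fun j _ => hasSum_sum fun k _ => (hasSum_poisson hs _).mul_right _
  have h3 : 0 ≤ ∑ j ∈ F, ∑ k ∈ F, (poisson s (x j - x k) - 1) * (d j * d k) := by
    refine h2.nonneg fun m => ?_
    have : ∑ j ∈ F, ∑ k ∈ F,
        2 * (s ^ (m + 1) * Real.cos ((m + 1 : ℕ) * (x j - x k))) * (d j * d k) =
        2 * s ^ (m + 1) * ((∑ j ∈ F, Real.cos ((m + 1 : ℕ) * x j) * d j) ^ 2 +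
          (∑ j ∈ F, Real.sin ((m + 1 : ℕ) * x j) * d j) ^ 2) := by
      rw [sq, sq, Finset.sum_mul_sum, Finset.sum_mul_sum, ← Finset.sum_add_distrib,
        Finset.mul_sum]
      refine Finset.sum_congr rfl fun j _ => ?_
      rw [← Finset.sum_add_distrib, Finset.mul_sum]
      refine Finset.sum_congr rfl fun k _ => ?_
      rw [mul_sub, Real.cos_sub]; ring
    rw [this]; positivity
  have h4 : ∑ j ∈ F, ∑ k ∈ F, poisson s (x j - x k) * (d j * d k) =
      ∑ j ∈ F, ∑ k ∈ F, (poisson s (x j - x k) - 1) * (d j * d k) + (∑ j ∈ F, d j) ^ 2 := by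
    rw [sq, Finset.sum_mul_sum, ← Finset.sum_add_distrib]
    refine Finset.sum_congr rfl fun j _ => ?_
    rw [← Finset.sum_add_distrib]
    refine Finset.sum_congr rfl fun k _ => by ring
  rw [h4]; positivity

/-! ### Translation of `k_Δ` and `Θ_Δ` to the parameter `t = e^{-λ}` -/

theorem nome_coe (Δ : ℝ) : nome (Δ : WithBot ℝ) = Real.exp (-lam Δ) := rfl

theorem nome_bot : nome ⊥ = 0 := rfl

theorem nome_nonneg (Δ : WithBot ℝ) : 0 ≤ nome Δ := by
  cases Δ with
  | bot => exact le_rfl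
  | coe Δ => exact (Real.exp_pos _).le

theorem nome_le {Δ : WithBot ℝ} {Δ₀ : ℝ} (h0 : Δ₀ < -1) (h : Δ ≤ (Δ₀ : WithBot ℝ)) :
    nome Δ ≤ nome (Δ₀ : WithBot ℝ) := by
  cases Δ with
  | bot => exact nome_nonneg _
  | coe Δ =>
    have h1 : Δ ≤ Δ₀ := WithBot.coe_le_coe.1 h
    rw [nome_coe, nome_coe, Real.exp_le_exp, neg_le_neg_iff]
    exact (Real.arcosh_le_arcosh (by linarith) (by linarith)).2 (by linarith)

theorem nome_lt_one {Δ : WithBot ℝ} {Δ₀ : ℝ} (h0 : Δ₀ < -1) (h : Δ ≤ (Δ₀ : WithBot ℝ)) :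
    nome Δ < 1 :=
  (nome_le h0 h).trans_lt (Real.exp_lt_one_iff.2 (by linarith [lam_pos h0]))

theorem kMap_eq_phase (Δ : WithBot ℝ) : kMap Δ = phase (nome Δ) := by
  cases Δ with
  | bot => funext α; rw [nome_bot, phase_zero_left]; rfl
  | coe Δ =>
    funext α
    show α + 2 * Real.arctan (Real.sin α / (Real.exp (lam Δ) - Real.cos α)) = _
    rw [phase, nome_coe, Real.exp_neg]
    have hE := (Real.exp_pos (lam Δ)).ne'
    congr 3
    have h1 : 1 - (Real.exp (lam Δ))⁻¹ * Real.cos α =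
        (Real.exp (lam Δ))⁻¹ * (Real.exp (lam Δ) - Real.cos α) := by field_simp
    rw [h1, mul_div_mul_left _ _ (inv_ne_zero hE)]

theorem two_mul_eq_nome {Δ : ℝ} (h : Δ < -1) :
    2 * Δ = -(nome (Δ : WithBot ℝ) + (nome (Δ : WithBot ℝ))⁻¹) := by
  have := cosh_lam h
  rw [Real.cosh_eq] at this
  rw [nome_coe, Real.exp_neg, inv_inv, ← Real.exp_neg]
  linarith

/-- In the variable `α`, the function `Θ_Δ` depends only on the difference of its arguments and is
again a phase function, with parameter `t²`. -/
theorem theta_kMap {Δ : WithBot ℝ} {Δ₀ : ℝ} (h0 : Δ₀ < -1) (h : Δ ≤ (Δ₀ : WithBot ℝ))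
    (α β : ℝ) : theta Δ (kMap Δ α) (kMap Δ β) = -phase (nome Δ ^ 2) (α - β) := by
  cases Δ with
  | bot =>
    show β - α = _
    rw [nome_bot, zero_pow two_ne_zero, phase_zero_left]; ring
  | coe Δ =>
    have hΔ : Δ < -1 := (WithBot.coe_le_coe.1 h).trans_lt h0
    have ht0 : 0 < nome (Δ : WithBot ℝ) := Real.exp_pos _
    have ht1 := nome_lt_one h0 h
    rw [kMap_eq_phase]
    set t := nome (Δ : WithBot ℝ) with ht
    have hts : |t| < 1 := by rwa [abs_of_pos ht0]
    have hts2 : |t ^ 2| < 1 := by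
      rw [abs_of_nonneg (sq_nonneg t)]; exact sq_lt_one_of_abs_lt hts
    have hc1 : Continuous fun α => theta Δ (phase t α) (phase t β) :=
      (theta_continuous hΔ).comp ((continuous_phase hts).prodMk continuous_const)
    have hc2 : Continuous fun α => -phase (t ^ 2) (α - β) :=
      ((continuous_phase hts2).comp (continuous_id.sub continuous_const)).neg
    refine congrFun (lift_unique hc1 hc2 β ?_ fun α => ?_) α
    · have : theta Δ (phase t β) (phase t β) = 0 := by
        show phase t β - phase t β + 2 * Real.arctan _ = 0
        simp
      rw [this]; simp [phase_zero_right]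
    · have e1 := exp_theta hΔ (phase t α) (phase t β)
      have e2 := exp_phase hts2 (α - β)
      have eX := exp_phase hts α
      have eY := exp_phase hts β
      have na := one_sub_mul_exp_ne_zero hts α
      have nb := one_sub_mul_exp_ne_zero hts β
      have nab := one_sub_mul_exp_ne_zero hts2 (α - β)
      have hX0 := Complex.exp_ne_zero (Complex.I * (phase t α : ℂ))
      have hY0 := Complex.exp_ne_zero (Complex.I * (phase t β : ℂ))
      have ha0 := Complex.exp_ne_zero (Complex.I * (α : ℂ))
      have hb0 := Complex.exp_ne_zero (Complex.I * (β : ℂ))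
      have hD : (2 : ℂ) * Δ = -((t : ℂ) + (t : ℂ)⁻¹) := by
        have := two_mul_eq_nome hΔ
        rw [← ht] at this
        exact_mod_cast this
      have htC : (t : ℂ) ≠ 0 := by exact_mod_cast ht0.ne'
      have eab : Complex.exp (Complex.I * ((α - β : ℝ) : ℂ)) =
          Complex.exp (Complex.I * α) / Complex.exp (Complex.I * β) := by
        rw [← Complex.exp_sub]; push_cast; ring_nf
      have exy : Complex.exp (Complex.I * ((phase t α : ℂ) - phase t β)) =
          Complex.exp (Complex.I * phase t α) / Complex.exp (Complex.I * phase t β) := by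
        rw [← Complex.exp_sub]; ring_nf
      suffices hs : Complex.exp (-(Complex.I * (theta Δ (phase t α) (phase t β) : ℂ))) =
          Complex.exp (Complex.I * (phase (t ^ 2) (α - β) : ℂ)) by
        rw [Complex.exp_neg] at hs
        push_cast
        rw [mul_neg, Complex.exp_neg, ← hs, inv_inv]
      rw [e1, e2, exy, Complex.exp_neg, Complex.exp_neg, hD]
      rw [eab] at nab ⊢
      set X := Complex.exp (Complex.I * (phase t α : ℂ))
      set Y := Complex.exp (Complex.I * (phase t β : ℂ))
      set a := Complex.exp (Complex.I * (α : ℂ))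
      set b := Complex.exp (Complex.I * (β : ℂ))
      have n1 : b - t ^ 2 * a ≠ 0 := by
        intro hh
        apply nab
        push_cast
        field_simp
        simpa using hh
      have h1t : (1 : ℂ) - t ^ 2 ≠ 0 := by
        have : (1 : ℝ) - t ^ 2 ≠ 0 := by linarith [sq_lt_one_of_abs_lt hts]
        exact_mod_cast this
      -- both sides of the quotient, cleared of denominators, are multiples of `1 - t ^ 2`
      have hXm : X * (1 - t * a) = a - t := by rw [eX, div_mul_cancel₀ _ na]
      have hYm : Y * (1 - t * b) = b - t := by rw [eY, div_mul_cancel₀ _ nb]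
      have k1 : (1 + X * Y + (t + (t : ℂ)⁻¹) * X) * ((1 - t * a) * (1 - t * b)) =
          (1 - t ^ 2) * (a - t ^ 2 * b) / t := by
        have e : (1 - t * a) * (1 - t * b) + (a - t) * (b - t) +
            (t + (t : ℂ)⁻¹) * (a - t) * (1 - t * b) = (1 - t ^ 2) * (a - t ^ 2 * b) / t := by
          field_simp; ring
        linear_combination e + (Y * (1 - t * b) + (t + (t : ℂ)⁻¹) * (1 - t * b)) * hXm +
          (a - t) * hYm
      have k2 : (1 + X * Y + (t + (t : ℂ)⁻¹) * Y) * ((1 - t * a) * (1 - t * b)) =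
          (1 - t ^ 2) * (b - t ^ 2 * a) / t := by
        have e : (1 - t * a) * (1 - t * b) + (a - t) * (b - t) +
            (t + (t : ℂ)⁻¹) * (b - t) * (1 - t * a) = (1 - t ^ 2) * (b - t ^ 2 * a) / t := by
          field_simp; ring
        linear_combination e + Y * (1 - t * b) * hXm +
          (a - t + (t + (t : ℂ)⁻¹) * (1 - t * a)) * hYm
      have hne : (1 + X * Y + (t + (t : ℂ)⁻¹) * Y) ≠ 0 := by
        intro hh
        rw [hh, zero_mul] at k2
        exact div_ne_zero (mul_ne_zero h1t n1) htC k2.symm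
      have l1 : X / Y * ((X⁻¹ + Y - -(t + (t : ℂ)⁻¹)) / (X + Y⁻¹ - -(t + (t : ℂ)⁻¹))) =
          (1 + X * Y + (t + (t : ℂ)⁻¹) * X) / (1 + X * Y + (t + (t : ℂ)⁻¹) * Y) := by
        have q1 : X⁻¹ + Y - -(t + (t : ℂ)⁻¹) = (1 + X * Y + (t + (t : ℂ)⁻¹) * X) / X := by
          field_simp; ring
        have q2 : X + Y⁻¹ - -(t + (t : ℂ)⁻¹) = (1 + X * Y + (t + (t : ℂ)⁻¹) * Y) / Y := by
          field_simp; ring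
        rw [q1, q2, div_div_div_eq, div_mul_div_comm,
          div_eq_div_iff (mul_ne_zero hY0 (mul_ne_zero hX0 hne)) hne]
        ring
      rw [l1, ← mul_div_mul_right _ _ (mul_ne_zero na nb), k1, k2]
      push_cast
      rw [div_div_div_cancel_right₀ htC, mul_div_mul_left _ _ h1t]
      field_simp

theorem contDiffAt_phase {z : ℝ × ℝ} (hz : |z.1| < 1) :
    ContDiffAt ℝ ω (fun z : ℝ × ℝ => phase z.1 z.2) z := by
  have h1 : 1 - z.1 * Real.cos z.2 ≠ 0 := by linarith [mul_cos_lt_one hz z.2]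
  have hs : ContDiffAt ℝ ω (fun z : ℝ × ℝ => Real.sin z.2) z :=
    Real.contDiff_sin.contDiffAt.comp z contDiffAt_snd
  have hc : ContDiffAt ℝ ω (fun z : ℝ × ℝ => Real.cos z.2) z :=
    Real.contDiff_cos.contDiffAt.comp z contDiffAt_snd
  exact contDiffAt_snd.add (contDiffAt_const.mul (Real.contDiff_arctan.contDiffAt.comp z
    ((contDiffAt_fst.mul hs).div (contDiffAt_const.sub (contDiffAt_fst.mul hc)) h1)))

/-! ### The limiting density as a Fourier series -/

/-- The number `1 / (2 cosh (λ (m+1)))` in terms of `t = e^{-λ}`; up to the factor `1 / π` it is the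
coefficient of `cos ((m+1) α)` in the limiting density. -/
noncomputable def modeCoeff (t : ℝ) (m : ℕ) : ℝ := t ^ (m + 1) / (1 + t ^ (2 * (m + 1)))

/-- The limiting density in the variable `α`, given by its Fourier series; it equals
`k'(α) ρ(k(α))` (see `dens_eq_mul_rho`). -/
noncomputable def dens (t α : ℝ) : ℝ :=
  1 / (4 * π) + 1 / π * ∑' m : ℕ, modeCoeff t m * Real.cos ((m + 1 : ℕ) * α)

theorem modeCoeff_nonneg {t : ℝ} (h0 : 0 ≤ t) (m : ℕ) : 0 ≤ modeCoeff t m := by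
  unfold modeCoeff; positivity

theorem modeCoeff_le {t t₀ : ℝ} (h0 : 0 ≤ t) (h1 : t ≤ t₀) (m : ℕ) :
    modeCoeff t m ≤ t₀ ^ (m + 1) := by
  have h2 : 0 ≤ t ^ (2 * (m + 1)) := by positivity
  calc modeCoeff t m ≤ t ^ (m + 1) := div_le_self (by positivity) (by linarith)
    _ ≤ _ := pow_le_pow_left₀ h0 h1 _

theorem abs_modeCoeff_mul_cos_le {t t₀ : ℝ} (h0 : 0 ≤ t) (h1 : t ≤ t₀) (m : ℕ) (x : ℝ) :
    |modeCoeff t m * Real.cos x| ≤ t₀ ^ (m + 1) := by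
  rw [abs_mul, abs_of_nonneg (modeCoeff_nonneg h0 m)]
  exact (mul_le_of_le_one_right (modeCoeff_nonneg h0 m) (Real.abs_cos_le_one x)).trans
    (modeCoeff_le h0 h1 m)

theorem summable_pow_succ {t : ℝ} (h0 : 0 ≤ t) (h1 : t < 1) :
    Summable fun m : ℕ => t ^ (m + 1) :=
  (summable_nat_add_iff 1).2 (summable_geometric_of_lt_one h0 h1)

theorem hasSum_dens {t : ℝ} (h0 : 0 ≤ t) (h1 : t < 1) (α : ℝ) :
    HasSum (fun m : ℕ => 1 / π * (modeCoeff t m * Real.cos ((m + 1 : ℕ) * α)))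
      (dens t α - 1 / (4 * π)) := by
  have : Summable fun m : ℕ => modeCoeff t m * Real.cos ((m + 1 : ℕ) * α) :=
    Summable.of_norm_bounded (summable_pow_succ h0 h1)
      fun m => abs_modeCoeff_mul_cos_le h0 le_rfl m _
  have h2 := this.hasSum.mul_left (1 / π)
  rwa [dens, add_sub_cancel_left]

theorem dens_zero (α : ℝ) : dens 0 α = 1 / (4 * π) := by simp [dens, modeCoeff]

theorem dens_neg (t α : ℝ) : dens t (-α) = dens t α := by
  simp only [dens, mul_neg, Real.cos_neg]

theorem dens_add_two_pi (t α : ℝ) : dens t (α + 2 * π) = dens t α := by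
  have : ∀ m : ℕ, Real.cos ((m + 1 : ℕ) * (α + 2 * π)) = Real.cos ((m + 1 : ℕ) * α) := by
    intro m
    rw [mul_add, Real.cos_add_nat_mul_two_pi]
  simp only [dens, this]

theorem continuousOn_dens {t₀ : ℝ} (ht : t₀ < 1) :
    ContinuousOn (fun z : ℝ × ℝ => dens z.1 z.2) (Icc 0 t₀ ×ˢ univ) := by
  rcases lt_or_ge t₀ 0 with h | h0
  · rw [Icc_eq_empty (not_le.2 h), empty_prod]; exact continuousOn_empty _
  refine continuousOn_const.add (continuousOn_const.mul ?_)
  refine continuousOn_tsum (u := fun m => t₀ ^ (m + 1)) (fun m => ?_) (summable_pow_succ h0 ht)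
    fun m z hz => abs_modeCoeff_mul_cos_le hz.1.1 hz.1.2 m _
  refine ContinuousOn.mul ?_ (by fun_prop)
  refine ContinuousOn.div (by fun_prop) (by fun_prop) fun z hz => ?_
  have : 0 ≤ z.1 := hz.1.1
  positivity

theorem continuous_dens {t : ℝ} (h0 : 0 ≤ t) (h1 : t < 1) : Continuous (dens t) := by
  have := (continuousOn_dens h1).comp_continuous (f := fun α : ℝ => ((t, α) : ℝ × ℝ))
    (by fun_prop) fun α => ⟨⟨h0, le_rfl⟩, mem_univ _⟩
  exact this

/-- The limiting densities are Lipschitz, uniformly in the parameter. -/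
theorem exists_abs_dens_sub_le {t₀ : ℝ} (ht₀ : 0 ≤ t₀) (ht : t₀ < 1) :
    ∃ C : ℝ, 0 ≤ C ∧ ∀ t, 0 ≤ t → t ≤ t₀ → ∀ α β, |dens t α - dens t β| ≤ C * |α - β| := by
  have hs : Summable fun m : ℕ => ((m + 1 : ℕ) : ℝ) * t₀ ^ (m + 1) := by
    have h := summable_pow_mul_geometric_of_norm_lt_one 1
      (by rwa [Real.norm_of_nonneg ht₀] : ‖t₀‖ < 1)
    simp only [pow_one] at h
    exact (summable_nat_add_iff 1).2 h
  refine ⟨1 / π * ∑' m : ℕ, ((m + 1 : ℕ) : ℝ) * t₀ ^ (m + 1), by positivity,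
    fun t h0 h1 α β => ?_⟩
  have hd := (hasSum_dens h0 (h1.trans_lt ht) α).sub (hasSum_dens h0 (h1.trans_lt ht) β)
  rw [sub_sub_sub_cancel_right] at hd
  rw [← Real.norm_eq_abs (dens t α - dens t β), ← hd.tsum_eq]
  refine tsum_of_norm_bounded ((hs.hasSum.mul_left (1 / π)).mul_right |α - β|) fun m => ?_
  rw [← mul_sub, ← mul_sub, Real.norm_eq_abs, abs_mul, abs_mul,
    abs_of_nonneg (modeCoeff_nonneg h0 m), abs_of_nonneg (by positivity : 0 ≤ 1 / π), mul_assoc]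
  refine mul_le_mul_of_nonneg_left ?_ (by positivity)
  have h3 := abs_cos_sub_cos_le ((m + 1 : ℕ) * α) ((m + 1 : ℕ) * β)
  rw [← mul_sub, abs_mul, Nat.abs_cast] at h3
  calc _ ≤ t₀ ^ (m + 1) * (((m + 1 : ℕ) : ℝ) * |α - β|) :=
        mul_le_mul (modeCoeff_le h0 h1 m) h3 (abs_nonneg _) (by positivity)
    _ = _ := by ring

/-! ### The linear integral equation satisfied by the limiting density -/

theorem hasSum_intervalIntegral_of_bound {F : ℕ → ℝ → ℝ} {f : ℝ → ℝ} {b : ℕ → ℝ}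
    (hF : ∀ m, Continuous (F m)) (hb : ∀ m x, |F m x| ≤ b m) (hs : Summable b)
    (hf : ∀ x, HasSum (fun m => F m x) (f x)) (u v : ℝ) :
    HasSum (fun m => ∫ x in u..v, F m x) (∫ x in u..v, f x) :=
  intervalIntegral.hasSum_integral_of_dominated_convergence (fun m _ => b m)
    (fun m => (hF m).aestronglyMeasurable) (fun m => ae_of_all _ fun x _ => hb m x)
    (ae_of_all _ fun _ _ => hs) intervalIntegrable_const (ae_of_all _ fun x _ => hf x)

theorem integral_cos_add_int_mul (c : ℝ) {j : ℤ} (hj : j ≠ 0) :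
    ∫ β in (-π)..π, Real.cos (c + j * β) = 0 := by
  have hj' : (j : ℝ) ≠ 0 := by exact_mod_cast hj
  rw [intervalIntegral.integral_comp_add_mul (fun x => Real.cos x) hj' c, integral_cos]
  have : c + j * π = (c + j * -π) + j * (2 * π) := by ring
  rw [this, Real.sin_add_int_mul_two_pi]; simp

theorem integral_cos_mul_cos (α : ℝ) (k l : ℕ) (hk : k ≠ 0) :
    ∫ β in (-π)..π, Real.cos (k * (α - β)) * Real.cos (l * β) =
      if k = l then π * Real.cos (k * α) else 0 := by
  have e : ∀ β, Real.cos (k * (α - β)) * Real.cos (l * β) =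
      1 / 2 * (Real.cos (k * α + ((l : ℤ) - (k : ℤ) : ℤ) * β) +
        Real.cos (k * α + (-(l : ℤ) - (k : ℤ) : ℤ) * β)) := by
    intro β
    have h1 : (k : ℝ) * α + ((l : ℤ) - (k : ℤ) : ℤ) * β = k * (α - β) + l * β := by
      push_cast; ring
    have h2 : (k : ℝ) * α + (-(l : ℤ) - (k : ℤ) : ℤ) * β = k * (α - β) - l * β := by
      push_cast; ring
    rw [h1, h2, Real.cos_add, Real.cos_sub]; ring
  simp_rw [e]
  rw [intervalIntegral.integral_const_mul, intervalIntegral.integral_add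
    (Continuous.intervalIntegrable (by fun_prop) _ _)
    (Continuous.intervalIntegrable (by fun_prop) _ _),
    integral_cos_add_int_mul _ (by omega : -(l : ℤ) - (k : ℤ) ≠ 0)]
  split_ifs with h
  · subst h
    simp
    ring
  · rw [integral_cos_add_int_mul _ (by omega)]; simp

theorem integral_poisson_mul_cos {s : ℝ} (h0 : 0 ≤ s) (h1 : s < 1) (α : ℝ) (l : ℕ) :
    ∫ β in (-π)..π, poisson s (α - β) * Real.cos (l * β) =
      2 * π * (s ^ l * Real.cos (l * α)) := by
  have hs : |s| < 1 := by rwa [abs_of_nonneg h0]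
  have h2 := hasSum_intervalIntegral_of_bound
    (F := fun m β => 2 * (s ^ (m + 1) * Real.cos ((m + 1 : ℕ) * (α - β))) * Real.cos (l * β))
    (f := fun β => (poisson s (α - β) - 1) * Real.cos (l * β))
    (b := fun m => 2 * s ^ (m + 1)) (fun m => by fun_prop) (fun m x => ?_)
    ((summable_pow_succ h0 h1).mul_left 2) (fun β => (hasSum_poisson hs _).mul_right _) (-π) π
  swap
  · rw [abs_mul, abs_mul, abs_mul, abs_of_nonneg (by positivity : 0 ≤ s ^ (m + 1)), abs_two]
    have := mul_le_one₀ (Real.abs_cos_le_one ((m + 1 : ℕ) * (α - x))) (abs_nonneg _)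
      (Real.abs_cos_le_one (l * x))
    calc _ = 2 * s ^ (m + 1) * (|Real.cos ((m + 1 : ℕ) * (α - x))| * |Real.cos (l * x)|) := by
          ring
      _ ≤ _ := mul_le_of_le_one_right (by positivity) this
  have h3 : ∀ m : ℕ, ∫ β in (-π)..π,
      2 * (s ^ (m + 1) * Real.cos ((m + 1 : ℕ) * (α - β))) * Real.cos (l * β) =
      if m + 1 = l then 2 * π * (s ^ l * Real.cos (l * α)) else 0 := by
    intro m
    have e : ∀ β, 2 * (s ^ (m + 1) * Real.cos ((m + 1 : ℕ) * (α - β))) * Real.cos (l * β) =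
        2 * s ^ (m + 1) * (Real.cos ((m + 1 : ℕ) * (α - β)) * Real.cos (l * β)) :=
      fun β => by ring
    simp_rw [e]
    rw [intervalIntegral.integral_const_mul, integral_cos_mul_cos _ _ _ (Nat.succ_ne_zero m)]
    split_ifs with h
    · subst h; simp only [Nat.succ_eq_add_one]; ring
    · simp
  simp_rw [h3] at h2
  have h4 : ∫ β in (-π)..π, poisson s (α - β) * Real.cos (l * β) =
      (∫ β in (-π)..π, (poisson s (α - β) - 1) * Real.cos (l * β)) +
        ∫ β in (-π)..π, Real.cos (l * β) := by
    have hc := continuous_poisson hs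
    rw [← intervalIntegral.integral_add (Continuous.intervalIntegrable (by fun_prop) _ _)
      (Continuous.intervalIntegrable (by fun_prop) _ _)]
    congr 1; funext β; ring
  rw [h4]
  rcases l with _ | l
  · have h5 : ∀ m : ℕ, (if m + 1 = 0 then 2 * π * (s ^ 0 * Real.cos ((0 : ℕ) * α)) else 0) = 0 :=
      fun m => if_neg (Nat.succ_ne_zero m)
    simp_rw [h5] at h2
    rw [h2.unique hasSum_zero]
    simp
    ring
  · have h5 : HasSum (fun m : ℕ => if m + 1 = l + 1 then
        2 * π * (s ^ (l + 1) * Real.cos ((l + 1 : ℕ) * α)) else 0)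
        (2 * π * (s ^ (l + 1) * Real.cos ((l + 1 : ℕ) * α))) := by
      have := hasSum_ite_eq l (2 * π * (s ^ (l + 1) * Real.cos ((l + 1 : ℕ) * α)))
      simpa only [Nat.add_right_cancel_iff] using this
    rw [h2.unique h5]
    have := integral_cos_add_int_mul 0 (j := (l + 1 : ℕ)) (by omega)
    simp only [zero_add, Int.cast_natCast] at this
    rw [this, add_zero]

theorem hasSum_integral_poisson_mul_dens {s t : ℝ} (hs0 : 0 ≤ s) (hs1 : s < 1) (h0 : 0 ≤ t)
    (h1 : t < 1) (α : ℝ) :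
    HasSum (fun m : ℕ => 2 * (modeCoeff t m * (s ^ (m + 1) * Real.cos ((m + 1 : ℕ) * α))))
      ((∫ β in (-π)..π, poisson s (α - β) * dens t β) - 1 / 2) := by
  have hs : |s| < 1 := by rwa [abs_of_nonneg hs0]
  have hc := continuous_poisson hs
  have hcd := continuous_dens h0 h1
  have h2 := hasSum_intervalIntegral_of_bound
    (F := fun m β => poisson s (α - β) * (1 / π * (modeCoeff t m * Real.cos ((m + 1 : ℕ) * β))))
    (f := fun β => poisson s (α - β) * (dens t β - 1 / (4 * π)))
    (b := fun m => 1 / (1 - s) ^ 2 * (1 / π * t ^ (m + 1))) (fun m => by fun_prop)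
    (fun m x => ?_) (((summable_pow_succ h0 h1).mul_left _).mul_left _)
    (fun β => (hasSum_dens h0 h1 β).mul_left _) (-π) π
  swap
  · rw [abs_mul, abs_mul, abs_of_pos (poisson_pos hs _), abs_of_nonneg (by positivity : 0 ≤ 1 / π)]
    exact mul_le_mul (poisson_le hs0 le_rfl hs1 _) (mul_le_mul_of_nonneg_left
      (abs_modeCoeff_mul_cos_le h0 le_rfl m _) (by positivity)) (by positivity) (by positivity)
  convert! h2 using 1
  · funext m
    have e : ∀ β, poisson s (α - β) * (1 / π * (modeCoeff t m * Real.cos ((m + 1 : ℕ) * β))) =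
        1 / π * modeCoeff t m * (poisson s (α - β) * Real.cos ((m + 1 : ℕ) * β)) :=
      fun β => by ring
    simp_rw [e]
    rw [intervalIntegral.integral_const_mul, integral_poisson_mul_cos hs0 hs1]
    field_simp
  · have h3 := integral_poisson_mul_cos hs0 hs1 α 0
    simp only [Nat.cast_zero, zero_mul, Real.cos_zero, mul_one, pow_zero] at h3
    simp_rw [mul_sub]
    rw [intervalIntegral.integral_sub (Continuous.intervalIntegrable (by fun_prop) _ _)
      (Continuous.intervalIntegrable (by fun_prop) _ _), intervalIntegral.integral_mul_const, h3]
    field_simp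
    ring

/-- The linear integral equation that determines the limiting density. -/
theorem poisson_eq_dens_add_integral {t : ℝ} (h0 : 0 ≤ t) (h1 : t < 1) (α : ℝ) :
    poisson t α = 2 * π * dens t α + ∫ β in (-π)..π, poisson (t ^ 2) (α - β) * dens t β := by
  have hs : |t| < 1 := by rwa [abs_of_nonneg h0]
  have h2 := hasSum_integral_poisson_mul_dens (sq_nonneg t) (sq_lt_one_of_abs_lt hs) h0 h1 α
  have h3 := (hasSum_dens h0 h1 α).mul_left (2 * π)
  have h4 := (h3.add h2).unique (f := fun m : ℕ => _) (by
    convert! hasSum_poisson hs α using 1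
    funext m
    rw [modeCoeff]
    have : (1 : ℝ) + t ^ (2 * (m + 1)) ≠ 0 := by positivity
    rw [← pow_mul]
    field_simp)
  have h5 : 2 * π * (1 / (4 * π)) = 1 / 2 := by field_simp; norm_num
  linarith

theorem integral_dens {t : ℝ} (h0 : 0 ≤ t) (h1 : t < 1) :
    ∫ β in (-π)..π, dens t β = 1 / 2 := by
  have h2 := hasSum_integral_poisson_mul_dens le_rfl zero_lt_one h0 h1 0
  have h3 : ∀ m : ℕ, 2 * (modeCoeff t m * ((0 : ℝ) ^ (m + 1) * Real.cos ((m + 1 : ℕ) * (0 : ℝ))))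
      = 0 := fun m => by simp
  simp_rw [h3] at h2
  have h4 := h2.unique hasSum_zero
  simp [poisson] at h4
  linarith

/-! ### The limiting density as a sum of hyperbolic secants -/

/-- The Fourier transform of the hyperbolic secant.  The substitution `x = e^y / (2 cosh y)` turns
the integral into a Beta integral, evaluated by the reflection formula for `Γ`. -/
theorem integral_exp_div_cosh (a : ℝ) :
    ∫ y : ℝ, Complex.exp (Complex.I * (a * y)) / (Real.cosh y : ℂ) =
      (π / Real.cosh (π * a / 2) : ℝ) := by
  set u : ℂ := (1 + Complex.I * a) / 2 with hu
  have hure : 0 < u.re := by simp [hu]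
  have hvre : 0 < (1 - u).re := by simp [hu]; norm_num
  have h1 : Complex.betaIntegral u (1 - u) = π / Complex.sin (π * u) := by
    rw [Complex.betaIntegral_eq_Gamma_mul_div _ _ hure hvre, Complex.Gamma_mul_Gamma_one_sub]
    simp
  have h2 : Complex.sin (π * u) = (Real.cosh (π * a / 2) : ℂ) := by
    have : (π : ℂ) * u = ((π * a / 2 : ℝ) : ℂ) * Complex.I + π / 2 := by
      rw [hu]; push_cast; ring
    rw [this, Complex.sin_add_pi_div_two, Complex.cos_mul_I, Complex.ofReal_cosh]
  have hσ : ∀ y : ℝ, Real.sigmoid (2 * y) = Real.exp (y - Real.log (2 * Real.cosh y)) := by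
    intro y
    have hc := Real.cosh_pos y
    rw [Real.exp_sub, Real.exp_log (by positivity), Real.sigmoid_def, Real.cosh_eq,
      show -(2 * y) = -y + -y by ring, Real.exp_add, Real.exp_neg]
    have := Real.exp_pos y
    field_simp
  have hσ' : ∀ y : ℝ, 1 - Real.sigmoid (2 * y) =
      Real.exp (-y - Real.log (2 * Real.cosh y)) := by
    intro y
    rw [← Real.sigmoid_neg, show -(2 * y) = 2 * (-y) by ring, hσ, Real.cosh_neg]
  have himg : (fun y : ℝ => Real.sigmoid (2 * y)) '' univ = Ioo 0 1 := by
    rw [← Real.range_sigmoid, image_univ]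
    exact (mul_left_surjective₀ (two_ne_zero' ℝ)).range_comp Real.sigmoid
  have hinj : InjOn (fun y : ℝ => Real.sigmoid (2 * y)) univ := fun x _ y _ h => by
    have := Real.sigmoid_injective h
    linarith
  have hder : ∀ y ∈ (univ : Set ℝ), HasDerivWithinAt (fun y : ℝ => Real.sigmoid (2 * y))
      (Real.sigmoid (2 * y) * (1 - Real.sigmoid (2 * y)) * 2) univ y := by
    intro y _
    have h := (Real.hasDerivAt_sigmoid (2 * y)).comp y ((hasDerivAt_id y).const_mul 2)
    rw [mul_one] at h
    exact h.hasDerivWithinAt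
  -- with `x = sigmoid (2 y)` one has `x^(u-1) (1-x)^(v-1) dx = e^{iay} / cosh y dy` for `v = 1 - u`
  have h3 := integral_image_eq_integral_abs_deriv_smul MeasurableSet.univ hder hinj
    (fun x : ℝ => (x : ℂ) ^ (u - 1) * (1 - (x : ℂ)) ^ (1 - u - 1))
  rw [himg, ← integral_Ioc_eq_integral_Ioo, ← intervalIntegral.integral_of_le zero_le_one,
    setIntegral_univ] at h3
  change Complex.betaIntegral u (1 - u) = _ at h3
  rw [h1, h2] at h3
  rw [Complex.ofReal_div]
  have h4 : ∀ y : ℝ, Complex.exp (Complex.I * (a * y)) / (Real.cosh y : ℂ) =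
      |Real.sigmoid (2 * y) * (1 - Real.sigmoid (2 * y)) * 2| •
        (((Real.sigmoid (2 * y) : ℝ) : ℂ) ^ (u - 1) *
          (1 - ((Real.sigmoid (2 * y) : ℝ) : ℂ)) ^ (1 - u - 1)) := by
    intro y
    have hc := Real.cosh_pos y
    have e1 : (1 : ℂ) - ((Real.sigmoid (2 * y) : ℝ) : ℂ) =
        ((1 - Real.sigmoid (2 * y) : ℝ) : ℂ) := by push_cast; ring
    rw [e1, hσ', hσ, abs_of_pos (by positivity)]
    set ℓ := Real.log (2 * Real.cosh y) with hℓ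
    have e2 : (Real.cosh y : ℂ) = Complex.exp ℓ / 2 := by
      rw [← Complex.ofReal_exp, hℓ, Real.exp_log (by positivity)]; push_cast; ring
    have e3 : ∀ x : ℝ, ∀ w : ℂ, ((Real.exp x : ℝ) : ℂ) ^ w = Complex.exp (x * w) := by
      intro x w
      rw [Complex.cpow_def_of_ne_zero (by exact_mod_cast (Real.exp_pos x).ne'),
        ← Complex.ofReal_log (Real.exp_pos x).le, Real.log_exp]
    rw [e2, e3, e3, Complex.real_smul]
    push_cast
    rw [div_div_eq_mul_div, ← Complex.exp_add, ← Complex.exp_add, mul_right_comm,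
      ← Complex.exp_add, mul_div_right_comm, ← Complex.exp_sub]
    congr 2
    rw [hu]
    ring
  simp_rw [h4]
  exact h3.symm

theorem isBigO_div_cosh (C : ℝ) {c : ℝ} (hc : 0 < c) :
    (fun x : ℝ => ((C / Real.cosh (c * x) : ℝ) : ℂ)) =O[cocompact ℝ] (|·| ^ (-2 : ℝ)) := by
  refine Asymptotics.IsBigO.of_bound (2 * |C| / c ^ 2) ?_
  have h0 : ∀ᶠ x : ℝ in cocompact ℝ, x ≠ 0 := by
    have := (isCompact_singleton (x := (0 : ℝ))).compl_mem_cocompact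
    exact this
  filter_upwards [h0] with x hx
  have h1 : (c * x) ^ 2 / 2 ≤ Real.cosh (c * x) := by
    set y := c * x
    have e : Real.cosh y = Real.cosh (y / 2) ^ 2 + Real.sinh (y / 2) ^ 2 := by
      rw [← Real.cosh_two_mul, mul_div_cancel₀ _ two_ne_zero]
    have h4 : (y / 2) ^ 2 ≤ Real.sinh (y / 2) ^ 2 := by
      rw [sq_le_sq, Real.abs_sinh]
      exact Real.self_le_sinh_iff.2 (abs_nonneg _)
    have h5 := Real.cosh_sq (y / 2)
    nlinarith
  have h2 : 0 < (c * x) ^ 2 / 2 := by positivity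
  have h3 := Real.cosh_pos (c * x)
  rw [Complex.norm_real, Real.norm_eq_abs, abs_div, abs_of_pos h3, Real.norm_of_nonneg (by positivity),
    Real.rpow_neg (abs_nonneg _), Real.rpow_two, sq_abs]
  calc |C| / Real.cosh (c * x) ≤ |C| / ((c * x) ^ 2 / 2) := by gcongr
    _ = _ := by field_simp

theorem fourier_div_cosh {l : ℝ} (hl : 0 < l) (w : ℝ) :
    𝓕 (fun x : ℝ => ((1 / (4 * l) / Real.cosh (π ^ 2 / l * x) : ℝ) : ℂ)) w =
      ((1 / (4 * π) / Real.cosh (l * w) : ℝ) : ℂ) := by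
  rw [Real.fourier_real_eq_integral_exp_smul]
  have e : ∀ v : ℝ, Complex.exp (↑(-2 * π * v * w) * Complex.I) •
      ((1 / (4 * l) / Real.cosh (π ^ 2 / l * v) : ℝ) : ℂ) = (1 / (4 * l) : ℝ) *
      (fun y : ℝ => Complex.exp (Complex.I * ((-(2 * l * w / π) : ℝ) * y)) / (Real.cosh y : ℂ))
        (π ^ 2 / l * v) := by
    intro v
    have e1 : Complex.I * ((-(2 * l * w / π) : ℝ) * ((π ^ 2 / l * v : ℝ) : ℂ)) =
        ↑(-2 * π * v * w) * Complex.I := by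
      rw [← Complex.ofReal_mul, mul_comm]
      congr 2
      field_simp
    show _ = (1 / (4 * l) : ℝ) * (Complex.exp (Complex.I *
      ((-(2 * l * w / π) : ℝ) * ((π ^ 2 / l * v : ℝ) : ℂ))) / _)
    rw [e1, smul_eq_mul, Complex.ofReal_div]
    ring
  simp_rw [e]
  rw [integral_const_mul, Measure.integral_comp_mul_left (fun y : ℝ =>
    Complex.exp (Complex.I * ((-(2 * l * w / π) : ℝ) * y)) / (Real.cosh y : ℂ)) (π ^ 2 / l),
    integral_exp_div_cosh, Complex.real_smul, ← Complex.ofReal_mul, ← Complex.ofReal_mul]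
  congr 1
  have e2 : π * -(2 * l * w / π) / 2 = -(l * w) := by field_simp
  rw [e2, Real.cosh_neg, abs_of_pos (by positivity)]
  have := Real.cosh_pos (l * w)
  field_simp

/-- Poisson summation identifies the Fourier series of the limiting density with a sum of
translates of a hyperbolic secant. -/
theorem dens_exp_neg {l : ℝ} (hl : 0 < l) (α : ℝ) :
    dens (Real.exp (-l)) α =
      ∑' j : ℤ, 1 / (4 * l) / Real.cosh (π * (2 * π * j + α) / (2 * l)) := by
  set f : ℝ → ℂ := fun x => ((1 / (4 * l) / Real.cosh (π ^ 2 / l * x) : ℝ) : ℂ) with hf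
  have hF : 𝓕 f = fun w => ((1 / (4 * π) / Real.cosh (l * w) : ℝ) : ℂ) :=
    funext fun w => fourier_div_cosh hl w
  have hcont : Continuous f := by
    refine Complex.continuous_ofReal.comp (Continuous.div (by fun_prop) (by fun_prop) fun x => ?_)
    exact (Real.cosh_pos _).ne'
  have hO1 : f =O[cocompact ℝ] (|·| ^ (-2 : ℝ)) := isBigO_div_cosh _ (by positivity)
  have hO2 : (𝓕 f) =O[cocompact ℝ] (|·| ^ (-2 : ℝ)) := hF ▸ isBigO_div_cosh _ hl
  have hP := Real.tsum_eq_tsum_fourier_of_rpow_decay hcont one_lt_two hO1 hO2 (α / (2 * π))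
  have hsum : Summable fun n : ℤ => 𝓕 f n * fourier n ((α / (2 * π) : ℝ) : UnitAddCircle) := by
    refine Summable.of_norm ?_
    have h1 : ∀ n : ℤ, ‖𝓕 f n * fourier n ((α / (2 * π) : ℝ) : UnitAddCircle)‖ = ‖𝓕 f n‖ := by
      intro n
      rw [norm_mul, fourier_apply, Circle.norm_coe, mul_one]
    simp_rw [h1]
    exact (summable_of_isBigO (Real.summable_abs_int_rpow one_lt_two)
      (hO2.comp_tendsto Int.tendsto_coe_cofinite)).norm
  have hfour : ∀ n : ℤ, 𝓕 f n * fourier n ((α / (2 * π) : ℝ) : UnitAddCircle) =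
      ((1 / (4 * π) / Real.cosh (l * n) : ℝ) : ℂ) * (Real.cos (n * α) +
        Complex.I * Real.sin (n * α)) := by
    intro n
    rw [hF, fourier_coe_apply, ← exp_I_mul]
    congr 2
    push_cast
    have : (π : ℂ) ≠ 0 := by exact_mod_cast Real.pi_ne_zero
    field_simp
  have h2 := hsum.hasSum.nat_add_neg
  rw [← hP, ← hasSum_nat_add_iff' 1] at h2
  have h0 : 0 ≤ Real.exp (-l) := (Real.exp_pos _).le
  have h1 : Real.exp (-l) < 1 := Real.exp_lt_one_iff.2 (by linarith)
  have h3 := Complex.hasSum_ofReal.2 (hasSum_dens h0 h1 α)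
  have h4 := h3.unique (f := fun m : ℕ => _) (by
    convert! h2 using 1
    funext m
    rw [hfour, hfour]
    have hc : modeCoeff (Real.exp (-l)) m = 1 / 2 / Real.cosh (l * (m + 1 : ℕ)) := by
      rw [modeCoeff, Real.cosh_eq, ← Real.exp_nat_mul, ← Real.exp_nat_mul]
      have e1 : ((m + 1 : ℕ) : ℝ) * -l = -(l * (m + 1 : ℕ)) := by ring
      have e2 : ((2 * (m + 1) : ℕ) : ℝ) * -l = -(l * (m + 1 : ℕ)) + -(l * (m + 1 : ℕ)) := by
        push_cast; ring
      rw [e1, e2, Real.exp_add, Real.exp_neg]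
      have := Real.exp_pos (l * (m + 1 : ℕ))
      field_simp
    rw [hc]
    push_cast
    simp only [mul_neg, neg_mul, Complex.cos_neg, Complex.sin_neg, Complex.cosh_neg]
    ring)
  have h5 : ((dens (Real.exp (-l)) α : ℝ) : ℂ) = ∑' n : ℤ, f (α / (2 * π) + n) := by
    have hF0 : 𝓕 f 0 = (π : ℂ)⁻¹ * 4⁻¹ := by rw [hF]; simp
    simp [hF0] at h4
    linear_combination h4
  have h6 : ∀ n : ℤ, f (α / (2 * π) + n) =
      ((1 / (4 * l) / Real.cosh (π * (2 * π * n + α) / (2 * l)) : ℝ) : ℂ) := by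
    intro n
    show ((1 / (4 * l) / Real.cosh (π ^ 2 / l * (α / (2 * π) + n)) : ℝ) : ℂ) = _
    have e : π ^ 2 / l * (α / (2 * π) + n) = π * (2 * π * n + α) / (2 * l) := by
      field_simp
      ring
    rw [e]
  simp_rw [h6] at h5
  rw [← Complex.ofReal_tsum] at h5
  exact_mod_cast h5

theorem summable_div_cosh (C d : ℝ) {c : ℝ} (hc : 0 < c) :
    Summable fun j : ℤ => C / Real.cosh (c * j + d) := by
  have h1 : Summable fun j : ℤ => ((2 * |C| * Real.cosh d / Real.cosh (c * j) : ℝ) : ℂ) :=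
    summable_of_isBigO (Real.summable_abs_int_rpow one_lt_two)
      ((isBigO_div_cosh _ hc).comp_tendsto Int.tendsto_coe_cofinite)
  refine Summable.of_norm_bounded (Complex.summable_ofReal.1 h1) fun j => ?_
  have h2 := Real.cosh_pos (c * j + d)
  have h3 := Real.cosh_pos (c * j)
  have h4 : Real.cosh (c * j) ≤ 2 * Real.cosh d * Real.cosh (c * j + d) := by
    have e1 := Real.cosh_sub (c * j + d) d
    have e2 := Real.cosh_add (c * j + d) d
    have e3 := Real.cosh_pos (c * j + d + d)
    rw [add_sub_cancel_right] at e1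
    linarith
  rw [Real.norm_eq_abs, abs_div, abs_of_pos h2, div_le_div_iff₀ h2 h3]
  calc |C| * Real.cosh (c * j) ≤ |C| * (2 * Real.cosh d * Real.cosh (c * j + d)) :=
        mul_le_mul_of_nonneg_left h4 (abs_nonneg _)
    _ = _ := by ring

/-! ### Positivity of the limiting density, and its relation to `ρ_Δ` -/

theorem dens_pos {t : ℝ} (h0 : 0 ≤ t) (h1 : t < 1) (α : ℝ) : 0 < dens t α := by
  rcases h0.eq_or_lt with rfl | h
  · rw [dens_zero]; positivity
  have hl : 0 < -Real.log t := by linarith [Real.log_neg h h1]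
  have e : t = Real.exp (-(-Real.log t)) := by rw [neg_neg, Real.exp_log h]
  rw [e, dens_exp_neg hl]
  set l := -Real.log t
  have hs : Summable fun j : ℤ => 1 / (4 * l) / Real.cosh (π * (2 * π * j + α) / (2 * l)) := by
    refine (summable_div_cosh (1 / (4 * l)) (π * α / (2 * l))
      (by positivity : 0 < π ^ 2 / l)).congr fun j => ?_
    congr 2
    field_simp
  refine hs.tsum_pos (fun j => ?_) 0 ?_
  · have := Real.cosh_pos (π * (2 * π * j + α) / (2 * l)); positivity
  · have := Real.cosh_pos (π * (2 * π * (0 : ℤ) + α) / (2 * l)); positivity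

/-- The limiting densities are bounded below, uniformly in the parameter. -/
theorem exists_pos_le_dens {t₀ : ℝ} (h0 : 0 ≤ t₀) (ht : t₀ < 1) :
    ∃ m : ℝ, 0 < m ∧ ∀ t, 0 ≤ t → t ≤ t₀ → ∀ α, m ≤ dens t α := by
  have hK : IsCompact (Icc 0 t₀ ×ˢ Icc 0 (2 * π) : Set (ℝ × ℝ)) := isCompact_Icc.prod isCompact_Icc
  obtain ⟨z, hz, hmin⟩ := hK.exists_isMinOn ⟨(0, 0), ⟨le_rfl, h0⟩, ⟨le_rfl, by positivity⟩⟩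
    ((continuousOn_dens ht).mono (prod_mono_right (subset_univ _)))
  refine ⟨dens z.1 z.2, dens_pos hz.1.1 (hz.1.2.trans_lt ht) _, fun t h1 h2 α => ?_⟩
  have hp : Function.Periodic (dens t) (2 * π) := dens_add_two_pi t
  obtain ⟨y, hy, e⟩ := hp.exists_mem_Ico₀ (by positivity) α
  rw [e]
  exact hmin (show (t, y) ∈ _ from ⟨⟨h1, h2⟩, ⟨hy.1, hy.2.le⟩⟩)

theorem deriv_kMap {Δ : WithBot ℝ} {Δ₀ : ℝ} (h0 : Δ₀ < -1) (h : Δ ≤ (Δ₀ : WithBot ℝ)) (α : ℝ) :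
    deriv (kMap Δ) α = poisson (nome Δ) α := by
  rw [kMap_eq_phase]
  exact (hasDerivAt_phase (by rw [abs_of_nonneg (nome_nonneg Δ)]; exact nome_lt_one h0 h) α).deriv

theorem dens_eq_mul_rho {Δ : WithBot ℝ} {Δ₀ : ℝ} (h0 : Δ₀ < -1) (h : Δ ≤ (Δ₀ : WithBot ℝ)) {α : ℝ}
    (hα : α ∈ Icc (-π) π) :
    deriv (kMap Δ) α * rho Δ (kMap Δ α) = dens (nome Δ) α := by
  have hd := deriv_kMap h0 h α
  have hpos := poisson_pos (s := nome Δ)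
    (by rw [abs_of_nonneg (nome_nonneg Δ)]; exact nome_lt_one h0 h) α
  cases Δ with
  | bot =>
    rw [hd, nome_bot, dens_zero]
    show poisson 0 α * (1 / (4 * π)) = _
    simp [poisson]
  | coe Δ =>
    have hΔ : Δ < -1 := (WithBot.coe_le_coe.1 h).trans_lt h0
    have hk : kInv Δ (kMap Δ α) = α :=
      (kMap_bijOn hΔ).injOn.leftInvOn_invFunOn hα
    show _ * (1 / (4 * lam Δ * deriv (kMap Δ) (kInv Δ (kMap Δ α))) * _) = _
    have hl := lam_pos hΔ
    rw [hk, hd, nome_coe, dens_exp_neg hl]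
    rw [nome_coe] at hpos
    have e : ∀ j : ℤ, 1 / (4 * lam Δ) / Real.cosh (π * (2 * π * j + α) / (2 * lam Δ)) =
        1 / (4 * lam Δ) * (1 / Real.cosh (π * (2 * π * j + α) / (2 * lam Δ))) := fun j => by
      rw [mul_one_div]
    simp_rw [e]
    rw [tsum_mul_left, ← mul_assoc]
    congr 1
    field_simp

/-! ### Quantiles of the limiting density -/

/-- The primitive of the limiting density that vanishes at `0`. -/
noncomputable def cdf (t α : ℝ) : ℝ := ∫ β in (0 : ℝ)..α, dens t β

/-- The inverse of `cdf t : [-π, π] → [-1/4, 1/4]`. -/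
noncomputable def quantile (t : ℝ) : ℝ → ℝ := Function.invFunOn (cdf t) (Icc (-π) π)

theorem cdf_sub {t : ℝ} (h0 : 0 ≤ t) (h1 : t < 1) (α β : ℝ) :
    cdf t β - cdf t α = ∫ x in α..β, dens t x :=
  intervalIntegral.integral_interval_sub_left ((continuous_dens h0 h1).intervalIntegrable _ _)
    ((continuous_dens h0 h1).intervalIntegrable _ _)

theorem hasDerivAt_cdf {t : ℝ} (h0 : 0 ≤ t) (h1 : t < 1) (α : ℝ) :
    HasDerivAt (cdf t) (dens t α) α :=
  ((continuous_dens h0 h1).integral_hasStrictDerivAt 0 α).hasDerivAt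

theorem continuous_cdf {t : ℝ} (h0 : 0 ≤ t) (h1 : t < 1) : Continuous (cdf t) :=
  continuous_iff_continuousAt.2 fun α => (hasDerivAt_cdf h0 h1 α).continuousAt

theorem cdf_strictMono {t : ℝ} (h0 : 0 ≤ t) (h1 : t < 1) : StrictMono (cdf t) :=
  strictMono_of_deriv_pos fun α => by
    rw [(hasDerivAt_cdf h0 h1 α).deriv]; exact dens_pos h0 h1 α

theorem cdf_zero (t : ℝ) : cdf t 0 = 0 := intervalIntegral.integral_same

theorem cdf_neg (t α : ℝ) : cdf t (-α) = -cdf t α := by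
  have := intervalIntegral.integral_comp_neg (a := 0) (b := α) (dens t)
  simp only [dens_neg, neg_zero] at this
  rw [cdf, cdf, this, intervalIntegral.integral_symm (-α) 0]

theorem cdf_pi {t : ℝ} (h0 : 0 ≤ t) (h1 : t < 1) : cdf t π = 1 / 4 := by
  have h := cdf_sub h0 h1 (-π) π
  rw [integral_dens h0 h1, cdf_neg] at h
  linarith

theorem mul_sub_le_cdf_sub {t m : ℝ} (h0 : 0 ≤ t) (h1 : t < 1) (hm : ∀ x, m ≤ dens t x)
    {α β : ℝ} (h : α ≤ β) : m * (β - α) ≤ cdf t β - cdf t α := by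
  rw [cdf_sub h0 h1, mul_comm, ← smul_eq_mul, ← intervalIntegral.integral_const]
  exact intervalIntegral.integral_mono_on h intervalIntegrable_const
    ((continuous_dens h0 h1).intervalIntegrable _ _) fun x _ => hm x

theorem cdf_bijOn {t : ℝ} (h0 : 0 ≤ t) (h1 : t < 1) :
    BijOn (cdf t) (Icc (-π) π) (Icc (-(1 / 4)) (1 / 4)) := by
  have hm := cdf_strictMono h0 h1
  have hn : cdf t (-π) = -(1 / 4) := by rw [cdf_neg, cdf_pi h0 h1]
  refine ⟨fun α hα => ?_, hm.injective.injOn, ?_⟩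
  · rw [← hn, ← cdf_pi h0 h1]
    exact ⟨hm.monotone hα.1, hm.monotone hα.2⟩
  · have := intermediate_value_Icc (f := cdf t) (by linarith [Real.pi_pos] : -π ≤ π)
      (continuous_cdf h0 h1).continuousOn
    rwa [hn, cdf_pi h0 h1] at this

theorem quantile_mem {t s : ℝ} (h0 : 0 ≤ t) (h1 : t < 1) (hs : |s| ≤ 1 / 4) :
    quantile t s ∈ Icc (-π) π :=
  (cdf_bijOn h0 h1).surjOn.mapsTo_invFunOn (abs_le.1 hs)

theorem cdf_quantile {t s : ℝ} (h0 : 0 ≤ t) (h1 : t < 1) (hs : |s| ≤ 1 / 4) :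
    cdf t (quantile t s) = s :=
  (cdf_bijOn h0 h1).surjOn.rightInvOn_invFunOn (abs_le.1 hs)

theorem quantile_mono {t s s' : ℝ} (h0 : 0 ≤ t) (h1 : t < 1) (hs : |s| ≤ 1 / 4)
    (hs' : |s'| ≤ 1 / 4) (h : s ≤ s') : quantile t s ≤ quantile t s' := by
  rw [← (cdf_strictMono h0 h1).le_iff_le, cdf_quantile h0 h1 hs, cdf_quantile h0 h1 hs']
  exact h

theorem quantile_neg {t s : ℝ} (h0 : 0 ≤ t) (h1 : t < 1) (hs : |s| ≤ 1 / 4) :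
    quantile t (-s) = -quantile t s := by
  apply (cdf_strictMono h0 h1).injective
  rw [cdf_neg, cdf_quantile h0 h1 hs, cdf_quantile h0 h1 (by rwa [abs_neg])]

theorem continuousOn_cdf_left {t₀ : ℝ} (h0 : 0 ≤ t₀) (ht : t₀ < 1) (α : ℝ) :
    ContinuousOn (fun t => cdf t α) (Icc 0 t₀) := by
  have h1 : Continuous (Function.uncurry fun t x : ℝ => dens (max 0 (min t t₀)) x) :=
    (continuousOn_dens ht).comp_continuous
      (f := fun z : ℝ × ℝ => ((max 0 (min z.1 t₀), z.2) : ℝ × ℝ)) (by fun_prop)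
      fun z => ⟨⟨le_max_left _ _, max_le h0 (min_le_right _ _)⟩, mem_univ _⟩
  have h2 := intervalIntegral.continuous_parametric_intervalIntegral_of_continuous' (μ := volume)
    h1 0 α
  refine h2.continuousOn.congr fun t h => ?_
  show cdf t α = ∫ x in (0 : ℝ)..α, dens (max 0 (min t t₀)) x
  rw [min_eq_left h.2, max_eq_right h.1, cdf]

theorem continuousOn_quantile {t₀ : ℝ} (h0 : 0 ≤ t₀) (ht : t₀ < 1) {s : ℝ} (hs : |s| ≤ 1 / 4) :
    ContinuousOn (fun t => quantile t s) (Icc 0 t₀) := by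
  obtain ⟨m, hm, hmd⟩ := exists_pos_le_dens h0 ht
  intro u hu
  have h1 := continuousOn_cdf_left h0 ht (quantile u s) u hu
  rw [ContinuousWithinAt, tendsto_iff_dist_tendsto_zero] at h1 ⊢
  -- `m |q_t - q_u| ≤ |cdf t q_t - cdf t q_u| = |cdf u q_u - cdf t q_u|`
  have h2 := h1.const_mul m⁻¹
  rw [mul_zero] at h2
  refine squeeze_zero' (Eventually.of_forall fun _ => dist_nonneg) ?_ h2
  filter_upwards [self_mem_nhdsWithin] with t hT
  have hT1 : t < 1 := hT.2.trans_lt ht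
  have e1 := cdf_quantile hT.1 hT1 hs
  have e2 := cdf_quantile hu.1 (hu.2.trans_lt ht) hs
  rw [Real.dist_eq, Real.dist_eq, e2, ← div_eq_inv_mul, le_div_iff₀' hm]
  rcases le_total (quantile t s) (quantile u s) with h | h
  · have h3 := mul_sub_le_cdf_sub hT.1 hT1 (hmd t hT.1 hT.2) h
    rw [e1] at h3
    rw [abs_sub_comm, abs_of_nonneg (sub_nonneg.2 h)]
    exact h3.trans (le_abs_self _)
  · have h3 := mul_sub_le_cdf_sub hT.1 hT1 (hmd t hT.1 hT.2) h
    rw [e1] at h3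
    rw [abs_of_nonneg (sub_nonneg.2 h), abs_sub_comm]
    exact h3.trans (le_abs_self _)

/-! ### Quadrature at the quantiles -/

theorem abs_integral_mul_dens_le {t : ℝ} (h0 : 0 ≤ t) (h1 : t < 1) {ψ : ℝ → ℝ} {B u v : ℝ}
    (huv : u ≤ v) (hB : ∀ x ∈ Icc u v, |ψ x| ≤ B) :
    |∫ x in u..v, ψ x * dens t x| ≤ B * (cdf t v - cdf t u) := by
  have hc := continuous_dens h0 h1
  rw [cdf_sub h0 h1, ← intervalIntegral.integral_const_mul, ← Real.norm_eq_abs]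
  refine intervalIntegral.norm_integral_le_of_norm_le huv (ae_of_all _ fun x hx => ?_)
    (Continuous.intervalIntegrable (by fun_prop) _ _)
  rw [Real.norm_eq_abs, abs_mul, abs_of_pos (dens_pos h0 h1 x)]
  exact mul_le_mul_of_nonneg_right (hB x ⟨hx.1.le, hx.2⟩) (dens_pos h0 h1 x).le

/-- The `j`-th of `n` quantiles of the limiting density (`0 ≤ j < n`), at the heights `I_{j+1} / N`
(see `node_eq`). -/
noncomputable def node (t : ℝ) (N n j : ℕ) : ℝ := quantile t ((j + 1 / 2 - n / 2 : ℝ) / N)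

theorem abs_level_le {N n r : ℕ} (hN : N = 2 * (n + r)) {x : ℝ} (hx0 : 0 ≤ x) (hxn : x ≤ n) :
    |(x - n / 2) / N| ≤ 1 / 4 := by
  subst hN
  rcases Nat.eq_zero_or_pos (n + r) with h | h
  · rw [h]; simp
  have h2 : (0 : ℝ) < ((2 * (n + r) : ℕ) : ℝ) := by exact_mod_cast (by omega : 0 < 2 * (n + r))
  rw [abs_div, abs_of_pos h2, div_le_iff₀ h2, abs_le]
  have hr : (0 : ℝ) ≤ r := Nat.cast_nonneg r
  push_cast
  constructor <;> linarith

/-- Sums of a Lipschitz function over the quantiles approximate its integral against the limiting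
density: each cell between consecutive half-integer levels has mass `1 / N` and contains one
quantile, and the two ends left over, of total mass `r / N`, contribute at most `r B`. -/
theorem abs_integral_sub_sum_node_le {t : ℝ} (h0 : 0 ≤ t) (h1 : t < 1) {N n r : ℕ}
    (hN : N = 2 * (n + r)) (hN0 : 0 < N) {ψ : ℝ → ℝ} {L B : ℝ}
    (hL : ∀ x y, |ψ x - ψ y| ≤ L * |x - y|) (hB : ∀ x, |ψ x| ≤ B) :
    |N * (∫ x in (-π)..π, ψ x * dens t x) - ∑ j ∈ Finset.range n, ψ (node t N n j)| ≤
      2 * π * L + r * B := by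
  have hNR : (0 : ℝ) < N := by exact_mod_cast hN0
  have hL0 : 0 ≤ L := by
    have := (abs_nonneg _).trans (hL 1 0)
    simpa using this
  have hB0 : 0 ≤ B := (abs_nonneg _).trans (hB 0)
  have hcψ : Continuous ψ := by
    refine (LipschitzWith.of_dist_le_mul (K := ⟨L, hL0⟩) fun x y => ?_).continuous
    rw [Real.dist_eq, Real.dist_eq]; exact hL x y
  have hcd := continuous_dens h0 h1
  have hint : ∀ u v, IntervalIntegrable (fun x => ψ x * dens t x) volume u v :=
    fun u v => (hcψ.mul hcd).intervalIntegrable u v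
  set b : ℕ → ℝ := fun i => quantile t (((i : ℝ) - n / 2) / N) with hb
  have hlev : ∀ i : ℕ, i ≤ n → |((i : ℝ) - n / 2) / N| ≤ 1 / 4 := fun i hi =>
    abs_level_le hN (Nat.cast_nonneg i) (by exact_mod_cast hi)
  have hmem : ∀ i : ℕ, i ≤ n → b i ∈ Icc (-π) π := fun i hi => quantile_mem h0 h1 (hlev i hi)
  have hcb : ∀ i : ℕ, i ≤ n → cdf t (b i) = ((i : ℝ) - n / 2) / N :=
    fun i hi => cdf_quantile h0 h1 (hlev i hi)
  have hmono : ∀ i : ℕ, i < n → b i ≤ node t N n i ∧ node t N n i ≤ b (i + 1) := by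
    intro i hi
    have hi' : (i : ℝ) + 1 ≤ n := by exact_mod_cast hi
    have hl : |((i : ℝ) + 1 / 2 - n / 2) / N| ≤ 1 / 4 :=
      abs_level_le hN (by positivity) (by linarith)
    refine ⟨quantile_mono h0 h1 (hlev i hi.le) hl ?_, quantile_mono h0 h1 hl (hlev (i + 1) hi) ?_⟩
    · gcongr; linarith
    · gcongr; push_cast; linarith
  have hsplit : ∫ x in (-π)..π, ψ x * dens t x = (∫ x in (-π)..(b 0), ψ x * dens t x) +
      (∑ i ∈ Finset.range n, ∫ x in (b i)..(b (i + 1)), ψ x * dens t x) +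
      ∫ x in (b n)..π, ψ x * dens t x := by
    rw [intervalIntegral.sum_integral_adjacent_intervals fun i _ => hint _ _,
      intervalIntegral.integral_add_adjacent_intervals (hint _ _) (hint _ _),
      intervalIntegral.integral_add_adjacent_intervals (hint _ _) (hint _ _)]
  have hcell : ∀ i ∈ Finset.range n, |N * (∫ x in (b i)..(b (i + 1)), ψ x * dens t x) -
      ψ (node t N n i)| ≤ L * (b (i + 1) - b i) := by
    intro i hi
    have hi' := Finset.mem_range.1 hi
    obtain ⟨m1, m2⟩ := hmono i hi'
    have hmass : cdf t (b (i + 1)) - cdf t (b i) = 1 / N := by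
      rw [hcb _ hi', hcb _ hi'.le]; push_cast; ring
    have e : N * (∫ x in (b i)..(b (i + 1)), ψ x * dens t x) - ψ (node t N n i) =
        N * ∫ x in (b i)..(b (i + 1)), (ψ x - ψ (node t N n i)) * dens t x := by
      simp_rw [sub_mul]
      rw [intervalIntegral.integral_sub (hint _ _)
        (Continuous.intervalIntegrable (by fun_prop) _ _), intervalIntegral.integral_const_mul,
        ← cdf_sub h0 h1, hmass]
      field_simp
    rw [e, abs_mul, abs_of_pos hNR]
    have h3 := abs_integral_mul_dens_le h0 h1 (ψ := fun x => ψ x - ψ (node t N n i))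
      (B := L * (b (i + 1) - b i)) (m1.trans m2) fun x hx => (hL _ _).trans
        (mul_le_mul_of_nonneg_left (abs_le.2 ⟨by linarith [hx.1], by linarith [hx.2]⟩) hL0)
    rw [hmass] at h3
    calc _ ≤ N * (L * (b (i + 1) - b i) * (1 / N)) := mul_le_mul_of_nonneg_left h3 hNR.le
      _ = _ := by field_simp
  have hNr : (N : ℝ) = 2 * (n + r) := by rw [hN]; push_cast; ring
  have hleft : |N * ∫ x in (-π)..(b 0), ψ x * dens t x| ≤ r / 2 * B := by
    have h3 := abs_integral_mul_dens_le h0 h1 (hmem 0 (Nat.zero_le n)).1 fun x _ => hB x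
    rw [hcb 0 (Nat.zero_le n), cdf_neg, cdf_pi h0 h1] at h3
    rw [abs_mul, abs_of_pos hNR]
    calc _ ≤ N * (B * ((((0 : ℕ) : ℝ) - n / 2) / N - -(1 / 4))) :=
          mul_le_mul_of_nonneg_left h3 hNR.le
      _ = (N / 4 - n / 2) * B := by field_simp; push_cast; ring
      _ = _ := by rw [hNr]; ring
  have hright : |N * ∫ x in (b n)..π, ψ x * dens t x| ≤ r / 2 * B := by
    have h3 := abs_integral_mul_dens_le h0 h1 (hmem n le_rfl).2 fun x _ => hB x
    rw [hcb n le_rfl, cdf_pi h0 h1] at h3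
    rw [abs_mul, abs_of_pos hNR]
    calc _ ≤ N * (B * (1 / 4 - ((n : ℝ) - n / 2) / N)) :=
          mul_le_mul_of_nonneg_left h3 hNR.le
      _ = (N / 4 - n / 2) * B := by field_simp; ring
      _ = _ := by rw [hNr]; ring
  have hmid : |∑ i ∈ Finset.range n, (N * (∫ x in (b i)..(b (i + 1)), ψ x * dens t x) -
      ψ (node t N n i))| ≤ 2 * π * L := by
    refine (Finset.abs_sum_le_sum_abs _ _).trans ((Finset.sum_le_sum hcell).trans ?_)
    rw [← Finset.mul_sum, Finset.sum_range_sub, mul_comm]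
    exact mul_le_mul_of_nonneg_right
      (by linarith [(hmem n le_rfl).2, (hmem 0 (Nat.zero_le n)).1]) hL0
  rw [Finset.sum_sub_distrib, ← Finset.mul_sum] at hmid
  rw [hsplit]
  rw [abs_le] at *
  constructor <;> linarith [hleft.1, hleft.2, hright.1, hright.2, hmid.1, hmid.2]

/-! ### Zeros of strongly monotone maps on balls, and their analytic dependence on a parameter -/

section Monotone

variable {E : Type*} [NormedAddCommGroup E] [InnerProductSpace ℝ E]
  {F : E → E} {F' : E → E →L[ℝ] E} {a : E} {c ρ : ℝ}

theorem mul_norm_sq_le_inner_sub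
    (hF : ∀ x ∈ Metric.closedBall a ρ, HasFDerivAt F (F' x) x)
    (hpos : ∀ x ∈ Metric.closedBall a ρ, ∀ d, c * ‖d‖ ^ 2 ≤ ⟪F' x d, d⟫_ℝ)
    {x y : E} (hx : x ∈ Metric.closedBall a ρ) (hy : y ∈ Metric.closedBall a ρ) :
    c * ‖x - y‖ ^ 2 ≤ ⟪F x - F y, x - y⟫_ℝ := by
  have hseg : ∀ s ∈ Icc (0 : ℝ) 1, y + s • (x - y) ∈ Metric.closedBall a ρ := fun s hs =>
    (convex_closedBall a ρ).add_smul_sub_mem hy hx hs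
  have hder : ∀ s ∈ Icc (0 : ℝ) 1, HasDerivAt (fun s : ℝ => ⟪F (y + s • (x - y)), x - y⟫_ℝ)
      ⟪F' (y + s • (x - y)) (x - y), x - y⟫_ℝ s := by
    intro s hs
    have h1 : HasDerivAt (fun s : ℝ => y + s • (x - y)) (x - y) s := by
      simpa using ((hasDerivAt_id s).smul_const (x - y)).const_add y
    have h2 := (hF _ (hseg s hs)).comp_hasDerivAt s h1
    simpa using h2.inner ℝ (hasDerivAt_const s (x - y))
  obtain ⟨s, hs, h⟩ := exists_hasDerivAt_eq_slope _ _ zero_lt_one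
    (fun s hs => (hder s hs).continuousAt.continuousWithinAt) fun s hs => hder s ⟨hs.1.le, hs.2.le⟩
  have h2 := hpos _ (hseg s ⟨hs.1.le, hs.2.le⟩) (x - y)
  rw [h] at h2
  simpa [inner_sub_left] using h2

theorem mul_norm_le_norm_sub
    (hF : ∀ x ∈ Metric.closedBall a ρ, HasFDerivAt F (F' x) x)
    (hpos : ∀ x ∈ Metric.closedBall a ρ, ∀ d, c * ‖d‖ ^ 2 ≤ ⟪F' x d, d⟫_ℝ)
    {x y : E} (hx : x ∈ Metric.closedBall a ρ) (hy : y ∈ Metric.closedBall a ρ) :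
    c * ‖x - y‖ ≤ ‖F x - F y‖ := by
  have h1 := (mul_norm_sq_le_inner_sub hF hpos hx hy).trans (real_inner_le_norm _ _)
  rcases (norm_nonneg (x - y)).eq_or_lt with h | h
  · rw [← h, mul_zero]; exact norm_nonneg _
  · refine le_of_mul_le_mul_right ?_ h
    linarith [h1]

/-- A strongly monotone map on a closed ball that is small at the centre has a zero in the open
ball: `‖F‖²` has a minimum on the closed ball, which by strong monotonicity is not attained on the
sphere, and a critical point of `‖F‖²` is a zero of `F` because the derivative is positive. -/
theorem exists_zero_of_strongly_monotone [FiniteDimensional ℝ E] (hc : 0 < c) (hρ : 0 < ρ)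
    (hF : ∀ x ∈ Metric.closedBall a ρ, HasFDerivAt F (F' x) x)
    (hpos : ∀ x ∈ Metric.closedBall a ρ, ∀ d, c * ‖d‖ ^ 2 ≤ ⟪F' x d, d⟫_ℝ)
    (ha : 2 * ‖F a‖ < c * ρ) : ∃ x ∈ Metric.ball a ρ, F x = 0 := by
  have haB : a ∈ Metric.closedBall a ρ := Metric.mem_closedBall_self hρ.le
  have hcont : ContinuousOn (fun x => ‖F x‖ ^ 2) (Metric.closedBall a ρ) := fun x hx =>
    ((hF x hx).continuousAt.norm.pow 2).continuousWithinAt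
  obtain ⟨x, hx, hmin⟩ := (isCompact_closedBall a ρ).exists_isMinOn ⟨a, haB⟩ hcont
  have hle : ‖F x‖ ≤ ‖F a‖ := by
    have := hmin haB
    exact le_of_sq_le_sq this (norm_nonneg _)
  have hxb : x ∈ Metric.ball a ρ := by
    rw [mem_ball_iff_norm]
    by_contra hcon
    have h1 := mul_norm_le_norm_sub hF hpos hx haB
    have h2 : c * ρ ≤ c * ‖x - a‖ := mul_le_mul_of_nonneg_left (not_lt.1 hcon) hc.le
    have h3 := norm_sub_le (F x) (F a)
    linarith
  refine ⟨x, hxb, ?_⟩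
  have hloc : IsLocalMin (fun x => ‖F x‖ ^ 2) x :=
    hmin.isLocalMin (mem_of_superset (Metric.isOpen_ball.mem_nhds hxb) Metric.ball_subset_closedBall)
  have h0 := hloc.hasFDerivAt_eq_zero (hF x hx).norm_sq
  have h1 := congrArg (fun T : E →L[ℝ] ℝ => T (F x)) h0
  have h2 := hpos x hx (F x)
  simp at h1
  rw [real_inner_comm, h1] at h2
  have h3 : ‖F x‖ ^ 2 ≤ 0 := by
    by_contra h
    push Not at h
    nlinarith
  have h4 : ‖F x‖ = 0 := by nlinarith [norm_nonneg (F x)]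
  exact norm_eq_zero.1 h4

/-- The analytic implicit function theorem at a zero where the derivative in the second variable is
positive definite. -/
theorem exists_analytic_implicit [FiniteDimensional ℝ E] {G : ℝ × E → E} {u : ℝ} {x : E}
    {T : E →L[ℝ] E} (hG : ContDiffAt ℝ ω G (u, x)) (h0 : G (u, x) = 0)
    (hT : HasFDerivAt (fun y => G (u, y)) T x) (hc : 0 < c) (hpos : ∀ d, c * ‖d‖ ^ 2 ≤ ⟪T d, d⟫_ℝ) :
    ∃ A : ℝ → E, ContDiffAt ℝ ω A u ∧ A u = x ∧ ∀ᶠ v in 𝓝 u, G (v, A v) = 0 := by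
  have hω : (ω : WithTop ℕ∞) ≠ 0 := by simp
  have hinj : Function.Injective T := by
    rw [injective_iff_map_eq_zero]
    intro d hd
    have := hpos d
    rw [hd, inner_zero_left] at this
    have h4 : ‖d‖ = 0 := by
      by_contra h
      have : 0 < ‖d‖ ^ 2 := by positivity
      nlinarith
    exact norm_eq_zero.1 h4
  have hpart : fderiv ℝ G (u, x) ∘L .inr ℝ ℝ E = T := by
    have h1 := (hG.differentiableAt hω).hasFDerivAt
    have h2 : HasFDerivAt (fun y : E => ((u, y) : ℝ × E)) (ContinuousLinearMap.inr ℝ ℝ E) x :=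
      hasFDerivAt_prodMk_right u x
    exact (h1.comp x h2).unique hT
  have hinv : (fderiv ℝ G (u, x) ∘L .inr ℝ ℝ E).IsInvertible := by
    rw [hpart]
    refine ⟨(LinearEquiv.ofInjectiveEndo (T : E →ₗ[ℝ] E) hinj).toContinuousLinearEquiv, ?_⟩
    ext d
    rfl
  refine ⟨hG.implicitFunction hω hinv, hG.contDiffAt_implicitFunction hω hinv,
    hG.implicitFunction_apply_self hω hinv, ?_⟩
  filter_upwards [hG.eventually_apply_implicitFunction hω hinv] with v hv
  rw [hv, h0]

end Monotone

/-! ### The Bethe equations in the variables `α_j`, with `p_j = phase t α_j` -/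

/-- The counting function `N k(α) - ∑_k φ(α - x_k)` of a configuration `x`, which takes the value
`2π I_j` at `x_j` when `x` solves the Bethe equations. -/
noncomputable def counting (N : ℕ) {n : ℕ} (t : ℝ) (x : Fin n → ℝ) (α : ℝ) : ℝ :=
  N * phase t α - ∑ k, phase (t ^ 2) (α - x k)

/-- The derivative of the counting function. -/
noncomputable def countingSlope (N : ℕ) {n : ℕ} (t : ℝ) (x : Fin n → ℝ) (α : ℝ) : ℝ :=
  N * poisson t α - ∑ k, poisson (t ^ 2) (α - x k)

/-- The map whose zeros are the solutions of the Bethe equations. -/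
noncomputable def betheMap (N : ℕ) {n : ℕ} (t : ℝ) (x : EuclideanSpace ℝ (Fin n)) :
    EuclideanSpace ℝ (Fin n) :=
  WithLp.toLp 2 fun j => counting N t x (x j) - 2 * π * qI N n ((j : ℕ) + 1)

/-- The quantiles of the limiting density at the heights `I_j / N`. -/
noncomputable def nodes (N n : ℕ) (t : ℝ) : EuclideanSpace ℝ (Fin n) :=
  WithLp.toLp 2 fun j => node t N n j

theorem abs_sq_lt_one {t : ℝ} (hs : |t| < 1) : |t ^ 2| < 1 := by
  rw [abs_of_nonneg (sq_nonneg t)]; exact sq_lt_one_of_abs_lt hs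

theorem hasDerivAt_counting (N : ℕ) {n : ℕ} {t : ℝ} (hs : |t| < 1) (x : Fin n → ℝ) (α : ℝ) :
    HasDerivAt (counting N t x) (countingSlope N t x α) α := by
  refine ((hasDerivAt_phase hs α).const_mul (N : ℝ)).sub
    (HasDerivAt.fun_sum fun k _ => ?_)
  exact (hasDerivAt_phase (abs_sq_lt_one hs) (α - x k)).comp_sub_const α (x k)

theorem qI_succ (N n : ℕ) {j : ℕ} (hj : j < n) :
    qI N n (j + 1) = (j : ℝ) + 1 / 2 - n / 2 := by
  rw [qI, if_neg (by omega), if_neg (by omega)]; push_cast; ring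

theorem qI_rev (N n : ℕ) (j : Fin n) :
    qI N n ((Fin.rev j : ℕ) + 1) = -qI N n ((j : ℕ) + 1) := by
  rw [qI_succ N n (Fin.rev j).2, qI_succ N n j.2, Fin.val_rev, Nat.cast_sub (by omega)]
  push_cast; ring

theorem counting_add_two_pi (N : ℕ) {n : ℕ} (t : ℝ) (x : Fin n → ℝ) (α : ℝ) :
    counting N t x (α + 2 * π) = counting N t x α + 2 * π * (N - n) := by
  have h : ∀ k, phase (t ^ 2) (α + 2 * π - x k) = phase (t ^ 2) (α - x k) + 2 * π := fun k => by
    rw [← phase_add_two_pi]; congr 1; ring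
  simp only [counting, phase_add_two_pi, h, Finset.sum_add_distrib]
  simp
  ring

theorem counting_neg (N : ℕ) {n : ℕ} (t : ℝ) {x : Fin n → ℝ} (hx : ∀ j, x (Fin.rev j) = -x j)
    (α : ℝ) : counting N t x (-α) = -counting N t x α := by
  have h : ∑ k, phase (t ^ 2) (-α - x k) = -∑ k, phase (t ^ 2) (α - x k) := by
    rw [← Finset.sum_neg_distrib, ← Equiv.sum_comp Fin.revPerm]
    refine Finset.sum_congr rfl fun k _ => ?_
    rw [Fin.revPerm_apply, hx, ← phase_neg]
    congr 1; ring
  simp only [counting, phase_neg, h]; ring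

theorem counting_zero (N : ℕ) {n : ℕ} (t : ℝ) {x : Fin n → ℝ} (hx : ∀ j, x (Fin.rev j) = -x j) :
    counting N t x 0 = 0 := by
  have := counting_neg N t hx 0
  rw [neg_zero] at this
  linarith

theorem counting_pi (N : ℕ) {n : ℕ} (t : ℝ) {x : Fin n → ℝ} (hx : ∀ j, x (Fin.rev j) = -x j) :
    counting N t x π = π * (N - n) := by
  have h1 := counting_neg N t hx π
  have h2 := counting_add_two_pi N t x (-π)
  rw [show -π + 2 * π = π by ring, h1] at h2
  linarith

theorem nodes_rev {N n r : ℕ} (hN : N = 2 * (n + r)) {t : ℝ} (h0 : 0 ≤ t) (h1 : t < 1)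
    (j : Fin n) : nodes N n t (Fin.rev j) = -nodes N n t j := by
  have hj : ((j : ℕ) : ℝ) + 1 ≤ n := by exact_mod_cast j.2
  have h := quantile_neg h0 h1 (abs_level_le hN (x := (j : ℝ) + 1 / 2) (by positivity)
    (by linarith))
  show quantile t (((Fin.rev j : ℕ) + 1 / 2 - n / 2 : ℝ) / N) = -quantile t _
  rw [← h, Fin.val_rev, Nat.cast_sub (by omega)]
  congr 1
  push_cast; ring

theorem cdf_nodes {N n r : ℕ} (hN : N = 2 * (n + r)) {t : ℝ} (h0 : 0 ≤ t) (h1 : t < 1)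
    (j : Fin n) : cdf t (nodes N n t j) = qI N n ((j : ℕ) + 1) / N := by
  have hj : ((j : ℕ) : ℝ) + 1 ≤ n := by exact_mod_cast j.2
  rw [qI_succ N n j.2]
  exact cdf_quantile h0 h1 (abs_level_le hN (by positivity) (by linarith))

theorem nodes_mem {N n r : ℕ} (hN : N = 2 * (n + r)) {t : ℝ} (h0 : 0 ≤ t) (h1 : t < 1)
    (j : Fin n) : nodes N n t j ∈ Icc (-π) π := by
  have hj : ((j : ℕ) : ℝ) + 1 ≤ n := by exact_mod_cast j.2
  exact quantile_mem h0 h1 (abs_level_le hN (by positivity) (by linarith))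

theorem continuousOn_nodes {N n r : ℕ} (hN : N = 2 * (n + r)) {t₀ : ℝ} (h0 : 0 ≤ t₀)
    (ht : t₀ < 1) : ContinuousOn (nodes N n) (Icc 0 t₀) := by
  refine (PiLp.continuous_toLp 2 _).comp_continuousOn (continuousOn_pi.2 fun j => ?_)
  have hj : ((j : ℕ) : ℝ) + 1 ≤ n := by exact_mod_cast j.2
  exact continuousOn_quantile h0 ht (abs_level_le hN (by positivity) (by linarith))

theorem contDiffAt_betheMap (N : ℕ) {n : ℕ} {t : ℝ} (hs : |t| < 1)
    (x : EuclideanSpace ℝ (Fin n)) :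
    ContDiffAt ℝ ω (fun z : ℝ × EuclideanSpace ℝ (Fin n) => betheMap N z.1 z.2) (t, x) := by
  have hc : ∀ j, ContDiffAt ℝ ω (fun z : ℝ × EuclideanSpace ℝ (Fin n) => z.2 j) (t, x) :=
    fun j => (contDiffAt_euclidean.1 contDiffAt_snd) j
  refine contDiffAt_euclidean.2 fun j => ?_
  have hp1 : ContDiffAt ℝ ω (fun z : ℝ × EuclideanSpace ℝ (Fin n) => phase z.1 (z.2 j)) (t, x) :=
    ContDiffAt.comp (g := fun z : ℝ × ℝ => phase z.1 z.2)
      (f := fun z : ℝ × EuclideanSpace ℝ (Fin n) => (z.1, z.2 j)) (t, x)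
      (contDiffAt_phase (z := (t, x j)) hs) (contDiffAt_fst.prodMk (hc j))
  have hp2 : ∀ k, ContDiffAt ℝ ω (fun z : ℝ × EuclideanSpace ℝ (Fin n) =>
      phase (z.1 ^ 2) (z.2 j - z.2 k)) (t, x) := fun k =>
    ContDiffAt.comp (g := fun z : ℝ × ℝ => phase z.1 z.2)
      (f := fun z : ℝ × EuclideanSpace ℝ (Fin n) => (z.1 ^ 2, z.2 j - z.2 k)) (t, x)
      (contDiffAt_phase (z := (t ^ 2, x j - x k)) (abs_sq_lt_one hs)) ((contDiffAt_fst.pow 2).prodMk ((hc j).sub (hc k)))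
  exact ((contDiffAt_const.mul hp1).sub (ContDiffAt.sum fun k _ => hp2 k)).sub contDiffAt_const

theorem hasFDerivAt_betheMap (N : ℕ) {n : ℕ} {t : ℝ} (hs : |t| < 1)
    (x : EuclideanSpace ℝ (Fin n)) :
    HasFDerivAt (betheMap N t) (fderiv ℝ (betheMap N t) x) x := by
  have h := (contDiffAt_betheMap N hs x).comp x (contDiffAt_const.prodMk contDiffAt_id)
  exact (h.differentiableAt (by simp)).hasFDerivAt

theorem fderiv_betheMap_apply (N : ℕ) {n : ℕ} {t : ℝ} (hs : |t| < 1)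
    (x d : EuclideanSpace ℝ (Fin n)) (j : Fin n) :
    fderiv ℝ (betheMap N t) x d j =
      countingSlope N t x (x j) * d j + ∑ k, poisson (t ^ 2) (x j - x k) * d k := by
  have hline : HasDerivAt (fun s : ℝ => x + s • d) d 0 := by
    simpa using ((hasDerivAt_id (0 : ℝ)).smul_const d).const_add x
  have h1 : HasDerivAt (fun s : ℝ => betheMap N t (x + s • d)) (fderiv ℝ (betheMap N t) x d) 0 :=
    HasFDerivAt.comp_hasDerivAt (l := betheMap N t) (f := fun s : ℝ => x + s • d) (0 : ℝ) (by simpa using hasFDerivAt_betheMap N hs x) hline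
  have h2 := ((EuclideanSpace.proj j : EuclideanSpace ℝ (Fin n) →L[ℝ] ℝ).hasFDerivAt
    (x := betheMap N t (x + (0 : ℝ) • d))).comp_hasDerivAt 0 h1
  have hlin : ∀ u v : ℝ, HasDerivAt (fun s : ℝ => u + s * v) v 0 := fun u v => by
    simpa using ((hasDerivAt_id (0 : ℝ)).mul_const v).const_add u
  have h3 : HasDerivAt (fun s : ℝ => N * phase t (x j + s * d j) -
      ∑ k, phase (t ^ 2) (x j - x k + s * (d j - d k)) - 2 * π * qI N n ((j : ℕ) + 1))
      (N * (poisson t (x j) * d j) - ∑ k, poisson (t ^ 2) (x j - x k) * (d j - d k)) 0 := by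
    refine HasDerivAt.sub_const _ (HasDerivAt.sub (HasDerivAt.const_mul _ ?_)
      (HasDerivAt.fun_sum fun k _ => ?_))
    · exact HasDerivAt.comp (0 : ℝ) (by simpa using hasDerivAt_phase hs (x j)) (hlin _ _)
    · exact HasDerivAt.comp (0 : ℝ)
        (by simpa using hasDerivAt_phase (abs_sq_lt_one hs) (x j - x k)) (hlin _ _)
  have h4 := h2.unique (h3.congr_of_eventuallyEq (Eventually.of_forall fun s => ?_))
  · refine h4.trans ?_
    rw [countingSlope]
    simp_rw [mul_sub]
    rw [Finset.sum_sub_distrib, ← Finset.sum_mul]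
    ring
  · show counting N t (x + s • d) ((x + s • d) j) - _ = _
    simp only [counting, PiLp.add_apply, PiLp.smul_apply, smul_eq_mul]
    congr 3
    funext k
    congr 1; ring

/-- The derivative of the Bethe map is positive definite as soon as the counting function has
positive slope, because the Poisson kernel is positive semidefinite. -/
theorem le_inner_fderiv_betheMap (N : ℕ) {n : ℕ} {t c : ℝ} (h0 : 0 ≤ t) (h1 : t < 1)
    (x : EuclideanSpace ℝ (Fin n)) (hc : ∀ α, c ≤ countingSlope N t x α)
    (d : EuclideanSpace ℝ (Fin n)) :
    c * ‖d‖ ^ 2 ≤ ⟪fderiv ℝ (betheMap N t) x d, d⟫_ℝ := by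
  have hs : |t| < 1 := by rwa [abs_of_nonneg h0]
  have h2 := poisson_posSemidef (sq_nonneg t) (sq_lt_one_of_abs_lt hs) Finset.univ x d
  have e : ⟪fderiv ℝ (betheMap N t) x d, d⟫_ℝ = ∑ j, countingSlope N t x (x j) * d j ^ 2 +
      ∑ j, ∑ k, poisson (t ^ 2) (x j - x k) * (d j * d k) := by
    rw [PiLp.inner_apply, ← Finset.sum_add_distrib]
    refine Finset.sum_congr rfl fun j _ => ?_
    rw [fderiv_betheMap_apply N hs]
    simp only [RCLike.inner_apply, conj_trivial]
    rw [mul_add, Finset.mul_sum]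
    congr 1
    · ring
    · exact Finset.sum_congr rfl fun k _ => by ring
  rw [e, EuclideanSpace.real_norm_sq_eq, Finset.mul_sum]
  have h3 : ∑ j, c * d j ^ 2 ≤ ∑ j, countingSlope N t x (x j) * d j ^ 2 :=
    Finset.sum_le_sum fun j _ => mul_le_mul_of_nonneg_right (hc _) (sq_nonneg _)
  linarith

/-! ### Estimates near the quantiles -/

/-- By Cauchy-Schwarz, a Euclidean ball of radius `R / √N` has `ℓ¹`-radius at most `R`. -/
theorem sum_abs_sub_le {n N : ℕ} (hnN : n ≤ N) (hN0 : 0 < N) {R : ℝ} (hR : 0 ≤ R)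
    {x a : EuclideanSpace ℝ (Fin n)} (hx : x ∈ Metric.closedBall a (R / √N)) :
    ∑ k, |x k - a k| ≤ R := by
  have hNR : (0 : ℝ) < N := by exact_mod_cast hN0
  have h1 := sq_sum_le_card_mul_sum_sq (s := (Finset.univ : Finset (Fin n)))
    (f := fun k => |x k - a k|)
  have h2 : ∑ k, |x k - a k| ^ 2 = ‖x - a‖ ^ 2 := by
    rw [EuclideanSpace.real_norm_sq_eq]
    exact Finset.sum_congr rfl fun k _ => by rw [sq_abs]; rfl
  rw [h2, Finset.card_univ, Fintype.card_fin] at h1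
  rw [mem_closedBall_iff_norm] at hx
  have h3 : ‖x - a‖ ^ 2 ≤ R ^ 2 / N := by
    rw [← Real.sq_sqrt hNR.le, ← div_pow]
    exact pow_le_pow_left₀ (norm_nonneg _) hx 2
  have h4 : (n : ℝ) * ‖x - a‖ ^ 2 ≤ R ^ 2 := by
    calc (n : ℝ) * ‖x - a‖ ^ 2 ≤ N * (R ^ 2 / N) :=
          mul_le_mul (by exact_mod_cast hnN) h3 (sq_nonneg _) hNR.le
      _ = R ^ 2 := by field_simp
  exact le_of_sq_le_sq (h1.trans h4) hR

/-- Near the quantiles, the slope of the counting function is that of the limiting density, up to a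
bounded error. -/
theorem abs_countingSlope_sub_le {N n r : ℕ} (hN : N = 2 * (n + r)) (hN0 : 0 < N) {t t₀ L B R : ℝ}
    (h0 : 0 ≤ t) (h1 : t ≤ t₀) (ht₀ : t₀ < 1)
    (hL : ∀ s, 0 ≤ s → s ≤ t₀ → ∀ x y, |poisson s x - poisson s y| ≤ L * |x - y|)
    (hB : ∀ s, 0 ≤ s → s ≤ t₀ → ∀ x, poisson s x ≤ B) (hR : 0 ≤ R)
    {x : EuclideanSpace ℝ (Fin n)} (hx : x ∈ Metric.closedBall (nodes N n t) (R / √N)) (α : ℝ) :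
    |countingSlope N t x α - 2 * π * N * dens t α| ≤ 2 * π * L + r * B + L * R := by
  have h1' : t < 1 := h1.trans_lt ht₀
  have hs0 : 0 ≤ t ^ 2 := sq_nonneg t
  have hs1 : t ^ 2 ≤ t₀ := by nlinarith
  have hsa : |t ^ 2| < 1 := by rw [abs_of_nonneg hs0]; linarith
  have hL0 : 0 ≤ L := by
    have := (abs_nonneg _).trans (hL t h0 h1 1 0)
    simpa using this
  have hq := abs_integral_sub_sum_node_le h0 h1' hN hN0 (ψ := fun β => poisson (t ^ 2) (α - β))
    (L := L) (B := B) (fun u v => ?_) (fun u => ?_)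
  rotate_left
  · have := hL _ hs0 hs1 (α - u) (α - v)
    rwa [sub_sub_sub_cancel_left, abs_sub_comm v u] at this
  · rw [abs_of_pos (poisson_pos hsa _)]; exact hB _ hs0 hs1 _
  rw [Finset.sum_range] at hq
  have heq := poisson_eq_dens_add_integral h0 h1' α
  have hd : |∑ k, poisson (t ^ 2) (α - nodes N n t k) - ∑ k, poisson (t ^ 2) (α - x k)| ≤ L * R := by
    rw [← Finset.sum_sub_distrib]
    refine (Finset.abs_sum_le_sum_abs _ _).trans ?_
    refine (Finset.sum_le_sum (g := fun k => L * |x k - nodes N n t k|) fun k _ => ?_).trans ?_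
    · have := hL _ hs0 hs1 (α - nodes N n t k) (α - x k)
      rwa [sub_sub_sub_cancel_left] at this
    · rw [← Finset.mul_sum]
      exact mul_le_mul_of_nonneg_left (sum_abs_sub_le (by omega) hN0 hR hx) hL0
  have e : countingSlope N t x α - 2 * π * N * dens t α =
      (N * (∫ β in (-π)..π, poisson (t ^ 2) (α - β) * dens t β) -
        ∑ k : Fin n, poisson (t ^ 2) (α - node t N n k)) +
      (∑ k, poisson (t ^ 2) (α - nodes N n t k) - ∑ k, poisson (t ^ 2) (α - x k)) := by
    rw [countingSlope, heq]
    show _ = _ + (∑ k : Fin n, poisson (t ^ 2) (α - node t N n k) - _)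
    ring
  rw [e]
  exact (abs_add_le _ _).trans (add_le_add hq hd)

/-- The quantiles solve the Bethe equations up to a bounded error. -/
theorem norm_betheMap_nodes_le {N n r : ℕ} (hN : N = 2 * (n + r)) (hN0 : 0 < N) {t t₀ L B : ℝ}
    (h0 : 0 ≤ t) (h1 : t ≤ t₀) (ht₀ : t₀ < 1)
    (hL : ∀ s, 0 ≤ s → s ≤ t₀ → ∀ x y, |poisson s x - poisson s y| ≤ L * |x - y|)
    (hB : ∀ s, 0 ≤ s → s ≤ t₀ → ∀ x, poisson s x ≤ B) :
    ‖betheMap N t (nodes N n t)‖ ≤ √N * ((2 * π * L + r * B) * π) := by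
  have hNR : (0 : ℝ) < N := by exact_mod_cast hN0
  have h1' : t < 1 := h1.trans_lt ht₀
  have hs : |t| < 1 := by rwa [abs_of_nonneg h0]
  set C := 2 * π * L + r * B with hC
  have hslope : ∀ α, |countingSlope N t (nodes N n t) α - 2 * π * N * dens t α| ≤ C := fun α => by
    have := abs_countingSlope_sub_le hN hN0 h0 h1 ht₀ hL hB le_rfl
      (Metric.mem_closedBall_self (x := nodes N n t) (by simp)) α
    simpa using this
  have hC0 : 0 ≤ C := (abs_nonneg _).trans (hslope 0)
  have hcoord : ∀ j, |betheMap N t (nodes N n t) j| ≤ C * π := by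
    intro j
    -- `Z - 2πN cdf` vanishes at `0` by symmetry and has derivative `O(1)`
    have hder : ∀ α ∈ (univ : Set ℝ), HasDerivWithinAt
        (fun α => counting N t (nodes N n t) α - 2 * π * N * cdf t α)
        (countingSlope N t (nodes N n t) α - 2 * π * N * dens t α) univ α := fun α _ =>
      ((hasDerivAt_counting N hs _ α).sub ((hasDerivAt_cdf h0 h1' α).const_mul _)).hasDerivWithinAt
    have h2 := convex_univ.norm_image_sub_le_of_norm_hasDerivWithin_le hder
      (fun α _ => hslope α) (mem_univ 0) (mem_univ (nodes N n t j))
    rw [counting_zero N t (nodes_rev hN h0 h1'), cdf_zero, cdf_nodes hN h0 h1' j, sub_zero,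
      mul_zero, sub_zero, sub_zero, Real.norm_eq_abs, Real.norm_eq_abs] at h2
    have e : betheMap N t (nodes N n t) j = counting N t (nodes N n t) (nodes N n t j) -
        2 * π * N * (qI N n ((j : ℕ) + 1) / N) := by
      show _ - 2 * π * qI N n ((j : ℕ) + 1) = _
      field_simp
    rw [e]
    exact h2.trans (mul_le_mul_of_nonneg_left (abs_le.2 (nodes_mem hN h0 h1' j)) hC0)
  have h3 : ‖betheMap N t (nodes N n t)‖ ^ 2 ≤ (√N * (C * π)) ^ 2 := by
    rw [EuclideanSpace.real_norm_sq_eq, mul_pow, Real.sq_sqrt hNR.le]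
    calc ∑ j, betheMap N t (nodes N n t) j ^ 2 ≤ ∑ _j : Fin n, (C * π) ^ 2 :=
          Finset.sum_le_sum fun j _ => sq_le_sq' (abs_le.1 (hcoord j)).1 (abs_le.1 (hcoord j)).2
      _ = n * (C * π) ^ 2 := by simp
      _ ≤ N * (C * π) ^ 2 :=
          mul_le_mul_of_nonneg_right (by exact_mod_cast (by omega : n ≤ N)) (sq_nonneg _)
  exact le_of_sq_le_sq h3 (by positivity)

/-! ### Symmetry and ordering of the solutions -/

/-- The reflection `(x_1, …, x_n) ↦ (-x_n, …, -x_1)`. -/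
noncomputable def reflect {n : ℕ} (x : EuclideanSpace ℝ (Fin n)) : EuclideanSpace ℝ (Fin n) :=
  WithLp.toLp 2 fun j => -x (Fin.rev j)

theorem norm_reflect_sub {n : ℕ} (x a : EuclideanSpace ℝ (Fin n))
    (ha : ∀ j, a (Fin.rev j) = -a j) : ‖reflect x - a‖ = ‖x - a‖ := by
  rw [EuclideanSpace.norm_eq, EuclideanSpace.norm_eq]
  congr 1
  rw [← Equiv.sum_comp Fin.revPerm]
  refine Finset.sum_congr rfl fun k _ => ?_
  have : (reflect x - a) (Fin.revPerm k) = -(x - a) k := by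
    show -x (Fin.rev (Fin.rev k)) - a (Fin.rev k) = -(x k - a k)
    rw [ha, Fin.rev_rev]; ring
  rw [this, norm_neg]

theorem betheMap_reflect (N : ℕ) {n : ℕ} (t : ℝ) (x : EuclideanSpace ℝ (Fin n)) (j : Fin n) :
    betheMap N t (reflect x) j = -betheMap N t x (Fin.rev j) := by
  have h : ∑ k, phase (t ^ 2) (-x (Fin.rev j) - -x (Fin.rev k)) =
      -∑ k, phase (t ^ 2) (x (Fin.rev j) - x k) := by
    rw [← Finset.sum_neg_distrib, ← Equiv.sum_comp Fin.revPerm]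
    refine Finset.sum_congr rfl fun k _ => ?_
    rw [Fin.revPerm_apply, Fin.rev_rev, ← phase_neg]
    congr 1; ring
  show N * phase t (-x (Fin.rev j)) - ∑ k, phase (t ^ 2) (-x (Fin.rev j) - -x (Fin.rev k)) -
    2 * π * qI N n ((j : ℕ) + 1) = -(N * phase t (x (Fin.rev j)) -
      ∑ k, phase (t ^ 2) (x (Fin.rev j) - x k) - 2 * π * qI N n ((Fin.rev j : ℕ) + 1))
  rw [h, phase_neg, qI_rev]; ring

theorem counting_apply_of_zero {N n : ℕ} {t : ℝ} {x : EuclideanSpace ℝ (Fin n)}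
    (hz : betheMap N t x = 0) (j : Fin n) :
    counting N t x (x j) = 2 * π * qI N n ((j : ℕ) + 1) := by
  have : betheMap N t x j = 0 := by rw [hz]; rfl
  exact sub_eq_zero.1 this

theorem strictMono_counting {N n : ℕ} {t c : ℝ} (hs : |t| < 1) {x : Fin n → ℝ} (hc : 0 < c)
    (hslope : ∀ α, c ≤ countingSlope N t x α) : StrictMono (counting N t x) :=
  strictMono_of_deriv_pos fun α => by
    rw [(hasDerivAt_counting N hs x α).deriv]; exact hc.trans_le (hslope α)

theorem strictMono_of_zero {N n : ℕ} {t : ℝ} {x : EuclideanSpace ℝ (Fin n)}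
    (hm : StrictMono (counting N t x)) (hz : betheMap N t x = 0) : StrictMono x := by
  intro i j hij
  rw [← hm.lt_iff_lt, counting_apply_of_zero hz, counting_apply_of_zero hz, qI_succ N n i.2,
    qI_succ N n j.2]
  have : ((i : ℕ) : ℝ) < (j : ℕ) := by exact_mod_cast hij
  have hpi := Real.pi_pos
  refine mul_lt_mul_of_pos_left (by linarith) (by positivity)

theorem mem_Ioo_of_zero {N n r : ℕ} (hN : N = 2 * (n + r)) {t : ℝ} {x : EuclideanSpace ℝ (Fin n)}
    (hm : StrictMono (counting N t x)) (hz : betheMap N t x = 0)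
    (hx : ∀ j, x (Fin.rev j) = -x j) (j : Fin n) : x j ∈ Ioo (-π) π := by
  have key : ∀ j, x j < π := by
    intro j
    rw [← hm.lt_iff_lt, counting_apply_of_zero hz, counting_pi N t hx, qI_succ N n j.2]
    have hj : ((j : ℕ) : ℝ) + 1 ≤ n := by exact_mod_cast j.2
    have hpi := Real.pi_pos
    have hr : (0 : ℝ) ≤ r := Nat.cast_nonneg r
    have e : π * ((N : ℝ) - n) - 2 * π * ((j : ℝ) + 1 / 2 - n / 2) =
        2 * π * (n - (j + 1 / 2) + r) := by rw [hN]; push_cast; ring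
    have : 0 < 2 * π * ((n : ℝ) - (j + 1 / 2) + r) := mul_pos (by positivity) (by linarith)
    linarith
  refine ⟨?_, key j⟩
  have := key (Fin.rev j)
  rw [hx] at this
  linarith

/-! ### The step function `ρ_p` of a solution -/

theorem extCoord_zero {n : ℕ} (hn : 0 < n) (x : Fin n → ℝ) :
    extCoord x 0 = x ⟨n - 1, by omega⟩ - 2 * π := by
  rw [extCoord, if_pos rfl, coord, dif_pos ⟨hn, le_rfl⟩]

theorem extCoord_last {n : ℕ} (hn : 0 < n) (x : Fin n → ℝ) :
    extCoord x (n + 1) = x ⟨0, hn⟩ + 2 * π := by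
  rw [extCoord, if_neg (by omega), if_pos rfl, coord, dif_pos ⟨le_rfl, hn⟩]

theorem extCoord_succ {n j : ℕ} (hj : j < n) (x : Fin n → ℝ) :
    extCoord x (j + 1) = x ⟨j, hj⟩ := by
  rw [extCoord, if_neg (by omega), if_neg (by omega), coord, dif_pos ⟨by omega, by omega⟩]
  rfl

theorem extCoord_cases {n i : ℕ} (hi : i ≤ n + 1) : i = 0 ∨ (∃ j < n, i = j + 1) ∨ i = n + 1 := by
  rcases Nat.eq_zero_or_pos i with h | h
  · exact Or.inl h
  · rcases hi.eq_or_lt with h' | h'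
    · exact Or.inr (Or.inr h')
    · exact Or.inr (Or.inl ⟨i - 1, by omega, by omega⟩)

theorem extCoord_phase {n : ℕ} (hn : 0 < n) (t : ℝ) (x : Fin n → ℝ) {i : ℕ} (hi : i ≤ n + 1) :
    extCoord (fun j => phase t (x j)) i = phase t (extCoord x i) := by
  rcases extCoord_cases hi with rfl | ⟨j, hj, rfl⟩ | rfl
  · have h := phase_add_two_pi t (x ⟨n - 1, by omega⟩ - 2 * π)
    rw [sub_add_cancel] at h
    rw [extCoord_zero hn, extCoord_zero hn, h, add_sub_cancel_right]
  · rw [extCoord_succ hj, extCoord_succ hj]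
  · rw [extCoord_last hn, extCoord_last hn, phase_add_two_pi]

theorem counting_extCoord {N n : ℕ} (hn : 0 < n) {t : ℝ} {x : EuclideanSpace ℝ (Fin n)}
    (hz : betheMap N t x = 0) {i : ℕ} (hi : i ≤ n + 1) :
    counting N t x (extCoord x i) = 2 * π * qI N n i := by
  rcases extCoord_cases hi with rfl | ⟨j, hj, rfl⟩ | rfl
  · have h := counting_add_two_pi N t x (x ⟨n - 1, by omega⟩ - 2 * π)
    rw [sub_add_cancel, counting_apply_of_zero hz] at h
    have e : qI N n 0 = qI N n (n - 1 + 1) - (N - n) := by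
      rw [qI_succ N n (by omega : n - 1 < n), qI, if_pos rfl, Nat.cast_sub hn]
      push_cast; ring
    rw [extCoord_zero hn, e]
    linarith
  · rw [extCoord_succ hj, counting_apply_of_zero hz]
  · have h := counting_apply_of_zero hz ⟨0, hn⟩
    have e : qI N n (n + 1) = qI N n (0 + 1) + (N - n) := by
      rw [qI_succ N n hn, qI, if_neg (by omega), if_pos rfl]; push_cast; ring
    rw [extCoord_last hn, counting_add_two_pi, h, e]
    ring

theorem qI_gap {N n r : ℕ} (hN : N = 2 * (n + r)) (hn : 0 < n) {i : ℕ} (hi : i ≤ n) :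
    1 ≤ qI N n (i + 1) - qI N n i ∧ qI N n (i + 1) - qI N n i ≤ 2 * r + 1 := by
  have hNr : (N : ℝ) = 2 * (n + r) := by rw [hN]; push_cast; ring
  have hr : (0 : ℝ) ≤ r := Nat.cast_nonneg r
  have e : qI N n (i + 1) - qI N n i = 1 ∨ qI N n (i + 1) - qI N n i = 2 * r + 1 := by
    rcases Nat.eq_zero_or_pos i with rfl | h
    · right
      rw [qI_succ N n hn, qI, if_pos rfl, hNr]; push_cast; ring
    · obtain ⟨j, rfl⟩ : ∃ j, i = j + 1 := ⟨i - 1, by omega⟩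
      rcases hi.eq_or_lt with rfl | h'
      · right
        rw [qI_succ N (j + 1) (by omega : j < j + 1), qI, if_neg (by omega), if_pos rfl, hNr]
        push_cast; ring
      · left
        rw [qI_succ N n h', qI_succ N n (by omega)]; push_cast; ring
  rcases e with e | e <;> rw [e] <;> constructor <;> linarith

theorem exists_mem_Ico_succ {q : ℕ → ℝ} {y : ℝ} {m : ℕ} (h0 : q 0 ≤ y) (hm : y < q m) :
    ∃ i < m, q i ≤ y ∧ y < q (i + 1) := by
  induction m with
  | zero => exact absurd h0 (not_le.2 hm)
  | succ m ih =>
    rcases lt_or_ge y (q m) with h | h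
    · obtain ⟨i, hi, h'⟩ := ih h
      exact ⟨i, by omega, h'⟩
    · exact ⟨m, by omega, h, hm⟩

theorem stepRho_eq {N n : ℕ} {p : Fin n → ℝ}
    (hp : ∀ i ≤ n, extCoord p i < extCoord p (i + 1)) {i : ℕ} (hi : i ≤ n) {y : ℝ}
    (hy : y ∈ Ico (extCoord p i) (extCoord p (i + 1))) :
    stepRho N p y =
      (qI N n (i + 1) - qI N n i) / (N * (extCoord p (i + 1) - extCoord p i)) := by
  have hle : ∀ j k, j ≤ k → k ≤ n + 1 → extCoord p j ≤ extCoord p k := by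
    intro j k hjk
    induction k, hjk using Nat.le_induction with
    | base => exact fun _ => le_rfl
    | succ k _ ih => exact fun hk => (ih (by omega)).trans (hp k (by omega)).le
  rw [stepRho, Finset.sum_eq_single i]
  · rw [indicator_of_mem hy]
  · intro j hj hji
    have hj' := Finset.mem_range.1 hj
    refine indicator_of_notMem (fun hm => ?_) _
    rcases lt_or_gt_of_ne hji with h | h
    · have := hle (j + 1) i h (by omega)
      linarith [hm.2, hy.1]
    · have := hle (i + 1) j h (by omega)
      linarith [hm.1, hy.2]
  · intro h
    exact absurd (Finset.mem_range.2 (by omega)) h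

/-- On each step the value of `ρ_p` is, by the mean value theorem, a quotient of slopes of the
counting function and of `k`, which are close to the limiting ones because the steps have length
`O(1/N)`. -/
theorem abs_mul_stepRho_sub_dens_le {N n r : ℕ} (hN : N = 2 * (n + r)) (hn : 0 < n)
    {t m L B b C D : ℝ} (h0 : 0 ≤ t) (h1 : t < 1) (hm : 0 < m) (hb : 0 < b)
    {x : EuclideanSpace ℝ (Fin n)} (hz : betheMap N t x = 0) (hx : ∀ j, x (Fin.rev j) = -x j)
    (hslope : ∀ α, π * m * N ≤ countingSlope N t x α)
    (hdens : ∀ α, |countingSlope N t x α - 2 * π * N * dens t α| ≤ C)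
    (hL : ∀ α β, |poisson t α - poisson t β| ≤ L * |α - β|) (hB : ∀ α, poisson t α ≤ B)
    (hb' : ∀ α, b ≤ poisson t α) (hD : ∀ α β, |dens t α - dens t β| ≤ D * |α - β|)
    {α : ℝ} (hα : α ∈ Icc (-π) π) :
    |poisson t α * stepRho N (fun j => phase t (x j)) (phase t α) - dens t α| ≤
      (L * (2 * (2 * r + 1) / m) / b * B + C + D * (2 * (2 * r + 1) / m)) / N := by
  have hs : |t| < 1 := by rwa [abs_of_nonneg h0]
  have hs2 := abs_sq_lt_one hs
  have hpi := Real.pi_pos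
  have hNR : (0 : ℝ) < N := by exact_mod_cast (by omega : 0 < N)
  have hL0 : 0 ≤ L := by
    have := (abs_nonneg _).trans (hL 1 0)
    simpa using this
  have hD0 : 0 ≤ D := by
    have := (abs_nonneg _).trans (hD 1 0)
    simpa using this
  have hC0 : 0 ≤ C := (abs_nonneg _).trans (hdens 0)
  have hmono : StrictMono (counting N t x) :=
    strictMono_counting hs (by positivity) hslope
  have hk := phase_strictMono hs
  set X : ℕ → ℝ := extCoord x with hX
  have hXlt : ∀ i ≤ n, X i < X (i + 1) := by
    intro i hi
    rw [← hmono.lt_iff_lt, counting_extCoord hn hz (by omega), counting_extCoord hn hz (by omega)]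
    have := (qI_gap hN hn hi).1
    exact mul_lt_mul_of_pos_left (by linarith) (by positivity)
  have hX0 : X 0 ≤ α := by
    rw [hX, extCoord_zero hn]
    linarith [(mem_Ioo_of_zero hN hmono hz hx ⟨n - 1, by omega⟩).2, hα.1]
  have hXn : α < X (n + 1) := by
    rw [hX, extCoord_last hn]
    linarith [(mem_Ioo_of_zero hN hmono hz hx ⟨0, hn⟩).1, hα.2]
  obtain ⟨i, hi, hiα, hαi⟩ := exists_mem_Ico_succ hX0 hXn
  have hi' : i ≤ n := by omega
  have hstep := stepRho_eq (N := N) (p := fun j => phase t (x j)) (fun j hj => by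
    rw [extCoord_phase hn t x (by omega), extCoord_phase hn t x (by omega)]
    exact hk (hXlt j hj)) hi' (y := phase t α) (by
    rw [extCoord_phase hn t x (by omega), extCoord_phase hn t x (by omega)]
    exact ⟨hk.monotone hiα, hk hαi⟩)
  rw [extCoord_phase hn t x (by omega), extCoord_phase hn t x (by omega), ← hX] at hstep
  obtain ⟨hδ1, hδ2⟩ := qI_gap hN hn hi'
  have hcu := counting_extCoord hn hz (i := i) (by omega)
  have hcv := counting_extCoord hn hz (i := i + 1) (by omega)
  rw [← hX] at hcu hcv
  have huv := hXlt i hi'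
  set u := X i
  set v := X (i + 1)
  set δ := qI N n (i + 1) - qI N n i with hδ
  obtain ⟨ξ, hξ, eξ⟩ := exists_hasDerivAt_eq_slope (counting N t x) (countingSlope N t x) huv
    (fun y _ => (hasDerivAt_counting N hs x y).continuousAt.continuousWithinAt)
    fun y _ => hasDerivAt_counting N hs x y
  obtain ⟨η, hη, eη⟩ := exists_hasDerivAt_eq_slope (phase t) (poisson t) huv
    (fun y _ => (hasDerivAt_phase hs y).continuousAt.continuousWithinAt)
    fun y _ => hasDerivAt_phase hs y
  rw [hcu, hcv, ← mul_sub, ← hδ] at eξ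
  have hvu : 0 < v - u := sub_pos.2 huv
  have hη0 := poisson_pos hs η
  set w := countingSlope N t x ξ / (2 * π * N) with hw
  have hval : poisson t α * stepRho N (fun j => phase t (x j)) (phase t α) =
      poisson t α / poisson t η * w := by
    have e2 : phase t v - phase t u = poisson t η * (v - u) := by
      rw [eη, div_mul_cancel₀ _ hvu.ne']
    rw [hstep, e2, hw, eξ]
    field_simp
  have hlen : v - u ≤ 2 * (2 * r + 1) / m / N := by
    have h2 := hslope ξ
    rw [eξ, le_div_iff₀ hvu] at h2
    rw [div_div, le_div_iff₀ (by positivity)]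
    have h3 : π * ((v - u) * (m * N)) ≤ π * (2 * δ) := by linarith
    have h4 := le_of_mul_le_mul_left h3 hpi
    linarith
  have hw0 : 0 ≤ w := by
    have := hslope ξ
    have h2 : 0 < π * m * N := by positivity
    exact div_nonneg (by linarith) (by positivity)
  have hwB : w ≤ B := by
    have h2 : countingSlope N t x ξ ≤ N * B := by
      have h3 : 0 ≤ ∑ k, poisson (t ^ 2) (ξ - x k) :=
        Finset.sum_nonneg fun k _ => (poisson_pos hs2 _).le
      have h4 := mul_le_mul_of_nonneg_left (hB ξ) hNR.le
      rw [countingSlope]; linarith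
    have hB0 : 0 < B := (poisson_pos hs 0).trans_le (hB 0)
    rw [hw, div_le_iff₀ (by positivity)]
    have h5 : 1 ≤ 2 * π := by linarith [Real.pi_gt_three]
    have h6 := mul_le_mul_of_nonneg_right h5 (by positivity : 0 ≤ N * B)
    linarith
  have d1 : |poisson t α / poisson t η * w - w| ≤ L * (2 * (2 * r + 1) / m / N) / b * B := by
    have e3 : poisson t α / poisson t η * w - w =
        (poisson t α - poisson t η) / poisson t η * w := by field_simp
    rw [e3, abs_mul, abs_div, abs_of_pos hη0, abs_of_nonneg hw0]
    have h7 : |α - η| ≤ 2 * (2 * r + 1) / m / N :=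
      (abs_le.2 ⟨by linarith [hη.2], by linarith [hη.1]⟩ : |α - η| ≤ v - u).trans hlen
    have h8 : |poisson t α - poisson t η| ≤ L * (2 * (2 * r + 1) / m / N) :=
      (hL α η).trans (mul_le_mul_of_nonneg_left h7 hL0)
    exact mul_le_mul (div_le_div₀ (by positivity) h8 hb (hb' η)) hwB hw0 (by positivity)
  have d2 : |w - dens t ξ| ≤ C / N := by
    have e4 : w - dens t ξ = (countingSlope N t x ξ - 2 * π * N * dens t ξ) / (2 * π * N) := by
      rw [hw]; field_simp
    rw [e4, abs_div, abs_of_pos (by positivity : 0 < 2 * π * N)]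
    refine div_le_div₀ hC0 (hdens ξ) hNR ?_
    have h5 : 1 ≤ 2 * π := by linarith [Real.pi_gt_three]
    have h6 := mul_le_mul_of_nonneg_right h5 hNR.le
    linarith
  have d3 : |dens t ξ - dens t α| ≤ D * (2 * (2 * r + 1) / m / N) :=
    (hD ξ α).trans (mul_le_mul_of_nonneg_left
      ((abs_le.2 ⟨by linarith [hξ.1], by linarith [hξ.2]⟩ : |ξ - α| ≤ v - u).trans hlen) hD0)
  rw [hval]
  have e5 : (L * (2 * (2 * r + 1) / m) / b * B + C + D * (2 * (2 * r + 1) / m)) / N =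
      L * (2 * (2 * r + 1) / m / N) / b * B + C / N + D * (2 * (2 * r + 1) / m / N) := by
    field_simp
  rw [e5]
  calc _ = |(poisson t α / poisson t η * w - w) + (w - dens t ξ) + (dens t ξ - dens t α)| := by
        congr 1; ring
    _ ≤ _ := (abs_add_three _ _ _).trans (add_le_add (add_le_add d1 d2) d3)

/-! ### Analytic dependence on `Δ`, including `Δ = -∞` -/

/-- The parameter `t = e^{-λ}` as a function of `1 / Δ`; it is analytic at `0`, which stands for
`Δ = -∞`. -/
noncomputable def nomeInv (z : ℝ) : ℝ := -z / (1 + √(1 - z ^ 2))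

theorem nome_eq_nomeInv {Δ : ℝ} (h : Δ < -1) : nome (Δ : WithBot ℝ) = nomeInv Δ⁻¹ := by
  have hpos : 0 < -Δ := by linarith
  have hΔ0 : Δ ≠ 0 := by linarith
  have h1 : √((-Δ) ^ 2 - 1) = -Δ * √(1 - Δ⁻¹ ^ 2) := by
    rw [← Real.sqrt_sq hpos.le, ← Real.sqrt_mul (sq_nonneg _), Real.sqrt_sq hpos.le]
    congr 1
    field_simp
  have h2 : 0 ≤ √(1 - Δ⁻¹ ^ 2) := Real.sqrt_nonneg _
  rw [nome_coe, lam, Real.exp_neg, Real.exp_arcosh (by linarith), h1, nomeInv]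
  generalize √(1 - Δ⁻¹ ^ 2) = w at h2
  have h3 : 1 + w ≠ 0 := by linarith
  have h4 : -Δ + -Δ * w = -Δ * (1 + w) := by ring
  rw [h4, mul_inv, inv_neg, div_eq_mul_inv]

theorem contDiffAt_nomeInv {z : ℝ} (hz : z ^ 2 < 1) : ContDiffAt ℝ ω nomeInv z := by
  have h1 : ContDiffAt ℝ ω (fun z : ℝ => √(1 - z ^ 2)) z :=
    ContDiffAt.sqrt (contDiffAt_const.sub (contDiffAt_id.pow 2)) (by
      show 1 - z ^ 2 ≠ 0
      linarith)
  exact contDiffAt_id.neg.div (contDiffAt_const.add h1)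
    (by have := Real.sqrt_nonneg (1 - z ^ 2); linarith)

theorem contDiffAt_phase_comp {n : ℕ} {A : ℝ → EuclideanSpace ℝ (Fin n)} {u : ℝ} (hu : |u| < 1)
    (hA : ContDiffAt ℝ ω A u) : ContDiffAt ℝ ω (fun t => fun j => phase t (A t j)) u := by
  refine contDiffAt_pi.2 fun j => ?_
  exact ContDiffAt.comp (g := fun z : ℝ × ℝ => phase z.1 z.2) (f := fun t : ℝ => (t, A t j)) u
    (contDiffAt_phase (z := (u, A u j)) hu) (contDiffAt_id.prodMk ((contDiffAt_euclidean.1 hA) j))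

/-- Analyticity at a real `Δ` of a family that agrees with an analytic function of `t` at the values
of `t` in `[0, t₀]`. -/
theorem analyticAt_real_of_local {n : ℕ} {p : ℝ → Fin n → ℝ} {Δ₀ Δ : ℝ} (h0 : Δ₀ < -1)
    (h : Δ < Δ₀) {A : ℝ → Fin n → ℝ} (hA : ContDiffAt ℝ ω A (nome (Δ : WithBot ℝ)))
    (hpA : ∀ᶠ t in 𝓝[Icc 0 (nome (Δ₀ : WithBot ℝ))] (nome (Δ : WithBot ℝ)), p t = A t) :
    AnalyticAt ℝ (fun x : ℝ => p (nome (x : WithBot ℝ))) Δ := by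
  have hΔ : Δ < -1 := h.trans h0
  have hΔ0 : Δ ≠ 0 := by linarith
  have hz : Δ⁻¹ ^ 2 < 1 := by
    rw [inv_pow]
    exact inv_lt_one_of_one_lt₀ (by nlinarith)
  have hnear : ∀ᶠ x in 𝓝 Δ, x < Δ₀ := Iio_mem_nhds h
  have hc1 : ContDiffAt ℝ ω (fun x : ℝ => nomeInv x⁻¹) Δ :=
    (contDiffAt_nomeInv hz).comp Δ (contDiffAt_inv ℝ hΔ0)
  have hnome : ContDiffAt ℝ ω (fun x : ℝ => nome (x : WithBot ℝ)) Δ :=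
    hc1.congr_of_eventuallyEq (hnear.mono fun x hx => nome_eq_nomeInv (hx.trans h0))
  have hcomp : ContDiffAt ℝ ω (fun x : ℝ => A (nome (x : WithBot ℝ))) Δ := hA.comp Δ hnome
  refine (hcomp.congr_of_eventuallyEq ?_).analyticAt
  have ht : Tendsto (fun x : ℝ => nome (x : WithBot ℝ)) (𝓝 Δ)
      (𝓝[Icc 0 (nome (Δ₀ : WithBot ℝ))] (nome (Δ : WithBot ℝ))) :=
    tendsto_nhdsWithin_iff.2 ⟨hnome.continuousAt, hnear.mono fun x hx =>
      ⟨nome_nonneg _, nome_le h0 (WithBot.coe_le_coe.2 hx.le)⟩⟩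
  exact ht.eventually hpA

/-- Analyticity at `Δ = -∞` follows from analyticity in `t` at `0`, where only the values `t ≥ 0`
matter because `t` is positive for real `Δ`. -/
theorem analyticAtNegInfty_of_local {n : ℕ} {p : ℝ → Fin n → ℝ} {Δ₀ : ℝ} (h0 : Δ₀ < -1)
    {A : ℝ → Fin n → ℝ} (hA : ContDiffAt ℝ ω A 0)
    (hpA : ∀ᶠ t in 𝓝[Icc 0 (nome (Δ₀ : WithBot ℝ))] 0, p t = A t) :
    AnalyticAtNegInfty fun Δ => p (nome Δ) := by
  have hn0 : nomeInv 0 = 0 := by simp [nomeInv]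
  have hc : ContDiffAt ℝ ω (fun z => A (nomeInv z)) 0 :=
    ContDiffAt.comp 0 (by rwa [hn0]) (contDiffAt_nomeInv (by norm_num))
  obtain ⟨P, hP⟩ := hc.analyticAt
  have hsum := hasFPowerSeriesAt_iff.1 hP
  simp only [zero_add] at hsum
  have hA0 : A 0 = P.coeff 0 := by
    have h1 := hsum.self_of_nhds
    rw [hn0] at h1
    refine h1.unique ?_
    have := hasSum_single (f := fun m : ℕ => (0 : ℝ) ^ m • P.coeff m) 0 fun m hm => by
      rw [zero_pow hm, zero_smul]
    simpa using this
  have hp0 : p 0 = A 0 := hpA.self_of_nhdsWithin ⟨le_rfl, nome_nonneg _⟩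
  refine ⟨P.coeff, hp0.trans hA0, ?_⟩
  have ht : Tendsto (fun x : ℝ => nomeInv x⁻¹) atBot (𝓝 0) := by
    have h1 := (contDiffAt_nomeInv (z := 0) (by norm_num)).continuousAt
    rw [ContinuousAt, hn0] at h1
    exact h1.comp tendsto_inv_atBot_zero
  have hlt : ∀ᶠ x : ℝ in atBot, x < Δ₀ := eventually_lt_atBot Δ₀
  have ht' : Tendsto (fun x : ℝ => nome (x : WithBot ℝ)) atBot
      (𝓝[Icc 0 (nome (Δ₀ : WithBot ℝ))] 0) := by
    refine tendsto_nhdsWithin_iff.2 ⟨ht.congr' (hlt.mono fun x hx =>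
      (nome_eq_nomeInv (hx.trans h0)).symm), hlt.mono fun x hx =>
      ⟨nome_nonneg _, nome_le h0 (WithBot.coe_le_coe.2 hx.le)⟩⟩
  have hall : ∀ᶠ x : ℝ in atBot,
      HasSum (fun m : ℕ => x⁻¹ ^ m • P.coeff m) (p (nome (x : WithBot ℝ))) := by
    filter_upwards [tendsto_inv_atBot_zero.eventually hsum, ht'.eventually hpA, hlt]
      with x h1 h2 h3
    rw [h2, nome_eq_nomeInv (h3.trans h0)]
    exact h1
  obtain ⟨M, hM⟩ := eventually_atBot.1 hall
  exact ⟨min M (-1), by linarith [min_le_right M (-1)], fun x hx => hM x (hx.trans (min_le_left _ _))⟩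

/-! ### The family of solutions -/

/-- Near the quantiles the Bethe equations have exactly one solution for each `t`, and it depends
analytically on `t`. -/
theorem exists_solution_family {N n r : ℕ} (hN : N = 2 * (n + r)) (hN0 : 0 < N) {t₀ c R : ℝ}
    (ht0 : 0 ≤ t₀) (ht₀ : t₀ < 1) (hc : 0 < c) (hR : 0 < R)
    (hslope : ∀ t ∈ Icc 0 t₀, ∀ x ∈ Metric.closedBall (nodes N n t) (R / √N), ∀ α,
      c ≤ countingSlope N t x α)
    (hres : ∀ t ∈ Icc 0 t₀, 2 * ‖betheMap N t (nodes N n t)‖ < c * (R / √N)) :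
    ∃ sol : ℝ → EuclideanSpace ℝ (Fin n),
      (∀ t ∈ Icc 0 t₀, sol t ∈ Metric.closedBall (nodes N n t) (R / √N) ∧
        betheMap N t (sol t) = 0 ∧ ∀ j, sol t (Fin.rev j) = -sol t j) ∧
      ∀ u ∈ Icc 0 t₀, ∃ A : ℝ → EuclideanSpace ℝ (Fin n), ContDiffAt ℝ ω A u ∧
        ∀ᶠ t in 𝓝[Icc 0 t₀] u, sol t = A t := by
  have hNR : (0 : ℝ) < N := by exact_mod_cast hN0
  have hρ : 0 < R / √N := div_pos hR (Real.sqrt_pos.2 hNR)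
  have habs : ∀ t ∈ Icc 0 t₀, |t| < 1 := fun t ht => by
    rw [abs_of_nonneg ht.1]; exact ht.2.trans_lt ht₀
  have hpos : ∀ t ∈ Icc 0 t₀, ∀ x ∈ Metric.closedBall (nodes N n t) (R / √N), ∀ d,
      c * ‖d‖ ^ 2 ≤ ⟪fderiv ℝ (betheMap N t) x d, d⟫_ℝ := fun t ht x hx d =>
    le_inner_fderiv_betheMap N ht.1 (ht.2.trans_lt ht₀) x (hslope t ht x hx) d
  have huniq : ∀ t ∈ Icc 0 t₀, ∀ x ∈ Metric.closedBall (nodes N n t) (R / √N),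
      ∀ y ∈ Metric.closedBall (nodes N n t) (R / √N), betheMap N t x = 0 → betheMap N t y = 0 →
      x = y := by
    intro t ht x hx y hy hx0 hy0
    have h := mul_norm_le_norm_sub (fun z _ => hasFDerivAt_betheMap N (habs t ht) z)
      (hpos t ht) hx hy
    rw [hx0, hy0, sub_zero, norm_zero] at h
    have h2 : ‖x - y‖ ≤ 0 := by
      by_contra hcon
      push Not at hcon
      have := mul_pos hc hcon
      linarith
    exact sub_eq_zero.1 (norm_le_zero_iff.1 h2)
  have hex : ∀ t, t ∈ Icc 0 t₀ → ∃ x ∈ Metric.ball (nodes N n t) (R / √N), betheMap N t x = 0 :=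
    fun t ht => exists_zero_of_strongly_monotone hc hρ
      (fun z _ => hasFDerivAt_betheMap N (habs t ht) z) (hpos t ht) (hres t ht)
  choose! sol hsol using hex
  refine ⟨sol, fun t ht => ⟨Metric.ball_subset_closedBall (hsol t ht).1, (hsol t ht).2, ?_⟩, ?_⟩
  · have hmem := Metric.ball_subset_closedBall (hsol t ht).1
    have hr : reflect (sol t) = sol t := by
      refine huniq t ht _ ?_ _ hmem ?_ (hsol t ht).2
      · rw [mem_closedBall_iff_norm] at hmem ⊢
        rwa [norm_reflect_sub _ _ (nodes_rev hN ht.1 (ht.2.trans_lt ht₀))]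
      · ext j
        rw [betheMap_reflect, (hsol t ht).2]
        simp
    intro j
    have : reflect (sol t) j = sol t j := by rw [hr]
    rw [← this]
    show _ = - -sol t (Fin.rev j)
    rw [neg_neg]
  · intro u hu
    obtain ⟨A, hA, hAu, hA0⟩ := exists_analytic_implicit
      (G := fun z : ℝ × EuclideanSpace ℝ (Fin n) => betheMap N z.1 z.2)
      (contDiffAt_betheMap N (habs u hu) (sol u)) (hsol u hu).2
      (hasFDerivAt_betheMap N (habs u hu) (sol u)) hc
      (hpos u hu _ (Metric.ball_subset_closedBall (hsol u hu).1))
    refine ⟨A, hA, ?_⟩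
    have hcont : ContinuousWithinAt (fun t => ‖A t - nodes N n t‖) (Icc 0 t₀) u :=
      (hA.continuousAt.continuousWithinAt.sub (continuousOn_nodes hN ht0 ht₀ u hu)).norm
    have hlt : ‖A u - nodes N n u‖ < R / √N := by
      rw [hAu, ← mem_ball_iff_norm]; exact (hsol u hu).1
    filter_upwards [hcont.eventually (gt_mem_nhds hlt), hA0.filter_mono nhdsWithin_le_nhds,
      self_mem_nhdsWithin] with t h1 h2 h3
    exact huniq t h3 _ (Metric.ball_subset_closedBall (hsol t h3).1) _
      (mem_closedBall_iff_norm.2 h1.le) (hsol t h3).2 h2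

end BetheEq

open BetheEq in
theorem theorem2p2 (r : ℕ) (Δ₀ : ℝ) (hΔ₀ : Δ₀ < -1) :
    ∃ K : ℝ, 0 < K ∧ ∃ N₀ : ℕ, ∀ N : ℕ, N₀ ≤ N → ∀ n : ℕ, N = 2 * (n + r) →
      ∃ p : WithBot ℝ → Fin n → ℝ,
        (∀ Δ : WithBot ℝ, Δ ≤ (Δ₀ : WithBot ℝ) →
          p Δ ∈ BetheEq.symSet n ∧ BetheEq.IsBetheSolution Δ N (p Δ)) ∧
        (BetheEq.AnalyticAtNegInfty p ∧
          AnalyticOnNhd ℝ (fun x : ℝ => p (x : WithBot ℝ)) (Set.Iio Δ₀)) ∧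
        (∀ Δ : WithBot ℝ, Δ ≤ (Δ₀ : WithBot ℝ) →
          BetheEq.wNorm Δ (fun x => BetheEq.stepRho N (p Δ) x - BetheEq.rho Δ x) ≤
            ENNReal.ofReal (K / N)) := by
  set t₀ := nome (Δ₀ : WithBot ℝ) with ht₀_def
  have ht0 : 0 ≤ t₀ := nome_nonneg _
  have ht₀ : t₀ < 1 := nome_lt_one hΔ₀ le_rfl
  have h1t : 0 < 1 - t₀ := by linarith
  obtain ⟨m, hm, hmd⟩ := exists_pos_le_dens ht0 ht₀
  obtain ⟨D, hD0, hD⟩ := exists_abs_dens_sub_le ht0 ht₀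
  set L : ℝ := 2 / (1 - t₀) ^ 4 with hLdef
  set B : ℝ := 1 / (1 - t₀) ^ 2 with hBdef
  set b : ℝ := (1 - t₀) / 4 with hbdef
  have hL0 : 0 < L := by positivity
  have hB0 : 0 < B := by positivity
  have hb0 : 0 < b := by positivity
  have hL : ∀ s, 0 ≤ s → s ≤ t₀ → ∀ x y, |poisson s x - poisson s y| ≤ L * |x - y| :=
    fun s h0 h1 => abs_poisson_sub_le h0 h1 ht₀
  have hB : ∀ s, 0 ≤ s → s ≤ t₀ → ∀ x, poisson s x ≤ B := fun s h0 h1 => poisson_le h0 h1 ht₀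
  -- residual of the quantiles, radius of the ball, and slope error on that ball
  set C₀ : ℝ := 2 * Real.pi * L + r * B with hC₀
  have hC₀0 : 0 ≤ C₀ := by positivity
  set R : ℝ := (2 * C₀ + 1) / m with hRdef
  have hR : 0 < R := by positivity
  set C : ℝ := C₀ + L * R with hCdef
  have hC0 : 0 ≤ C := by positivity
  set K : ℝ := L * (2 * (2 * r + 1) / m) / b * B + C + D * (2 * (2 * r + 1) / m) with hK
  refine ⟨K, by positivity, ⌈C / (Real.pi * m)⌉₊ + 2 * r + 2, fun N hNN n hN => ?_⟩
  have hn : 0 < n := by omega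
  have hN0 : 0 < N := by omega
  have hNR : (0 : ℝ) < N := by exact_mod_cast hN0
  have hCN : C ≤ Real.pi * m * N := by
    have h1 : C / (Real.pi * m) ≤ N :=
      (Nat.le_ceil _).trans (by exact_mod_cast (by omega : ⌈C / (Real.pi * m)⌉₊ ≤ N))
    rwa [div_le_iff₀' (by positivity)] at h1
  have hdens : ∀ t ∈ Set.Icc 0 t₀, ∀ x ∈ Metric.closedBall (nodes N n t) (R / √N), ∀ α,
      |countingSlope N t x α - 2 * Real.pi * N * dens t α| ≤ C := fun t ht x hx α =>
    abs_countingSlope_sub_le hN hN0 ht.1 ht.2 ht₀ hL hB hR.le hx α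
  have hslope : ∀ t ∈ Set.Icc 0 t₀, ∀ x ∈ Metric.closedBall (nodes N n t) (R / √N), ∀ α,
      Real.pi * m * N ≤ countingSlope N t x α := by
    intro t ht x hx α
    have h1 := (abs_le.1 (hdens t ht x hx α)).1
    have h2 := mul_le_mul_of_nonneg_left (hmd t ht.1 ht.2 α)
      (by positivity : 0 ≤ 2 * Real.pi * N)
    linarith
  have hres : ∀ t ∈ Set.Icc 0 t₀,
      2 * ‖betheMap N t (nodes N n t)‖ < Real.pi * m * N * (R / √N) := by
    intro t ht
    have h1 := norm_betheMap_nodes_le hN hN0 ht.1 ht.2 ht₀ hL hB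
    have h2 : Real.pi * m * N * (R / √N) = √N * ((2 * C₀ + 1) * Real.pi) := by
      rw [hRdef]
      have : (N : ℝ) = √N * √N := (Real.mul_self_sqrt hNR.le).symm
      field_simp
      rw [Real.sq_sqrt hNR.le]
    rw [h2]
    have h3 : 0 < √(N : ℝ) * Real.pi := by positivity
    linarith
  obtain ⟨sol, hsol, hloc⟩ := exists_solution_family hN hN0 ht0 ht₀
    (by positivity : 0 < Real.pi * m * N) hR hslope hres
  have hnome : ∀ Δ : WithBot ℝ, Δ ≤ (Δ₀ : WithBot ℝ) → nome Δ ∈ Set.Icc 0 t₀ := fun Δ hΔ =>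
    ⟨nome_nonneg Δ, nome_le hΔ₀ hΔ⟩
  have hlocal : ∀ u ∈ Set.Icc 0 t₀, ∃ A : ℝ → Fin n → ℝ, ContDiffAt ℝ (⊤ : WithTop ℕ∞) A u ∧
      ∀ᶠ t in nhdsWithin u (Set.Icc 0 t₀), (fun j => phase t (sol t j)) = A t := by
    intro u hu
    obtain ⟨A, hA, hAe⟩ := hloc u hu
    refine ⟨fun t j => phase t (A t j), contDiffAt_phase_comp
      (by rw [abs_of_nonneg hu.1]; exact hu.2.trans_lt ht₀) hA, ?_⟩
    filter_upwards [hAe] with t ht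
    rw [ht]
  refine ⟨fun Δ j => phase (nome Δ) (sol (nome Δ) j), fun Δ hΔ => ?_, ⟨?_, ?_⟩, fun Δ hΔ => ?_⟩
  · have ht := hnome Δ hΔ
    set t := nome Δ
    have hs : |t| < 1 := by rw [abs_of_nonneg ht.1]; exact ht.2.trans_lt ht₀
    obtain ⟨hmem, hz, hsym⟩ := hsol t ht
    have hmono := strictMono_counting hs (by positivity) (hslope t ht _ hmem)
    have hk := phase_strictMono hs
    refine ⟨⟨fun j => ?_, fun i j hij => hk (strictMono_of_zero hmono hz hij), fun j => ?_⟩,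
      fun j => ?_⟩
    · have h := mem_Ioo_of_zero hN hmono hz hsym j
      constructor
      · rw [← phase_pi t, ← phase_neg]; exact hk h.1
      · conv_rhs => rw [← phase_pi t]
        exact hk h.2
    · show phase t (sol t (Fin.rev j)) = -phase t (sol t j)
      rw [hsym, phase_neg]
    · have h := counting_apply_of_zero hz j
      have hth : ∀ k, theta Δ (phase t (sol t j)) (phase t (sol t k)) =
          -phase (t ^ 2) (sol t j - sol t k) := fun k => by
        have := theta_kMap hΔ₀ hΔ (sol t j) (sol t k)
        rwa [kMap_eq_phase] at this
      show N * phase t (sol t j) = 2 * Real.pi * qI N n ((j : ℕ) + 1) -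
        ∑ k, theta Δ (phase t (sol t j)) (phase t (sol t k))
      rw [Finset.sum_congr rfl fun k _ => hth k, Finset.sum_neg_distrib]
      rw [counting] at h
      linarith
  · obtain ⟨A, hA, hAe⟩ := hlocal 0 ⟨le_rfl, ht0⟩
    exact analyticAtNegInfty_of_local (p := fun t j => phase t (sol t j)) hΔ₀ hA hAe
  · intro Δ hΔ
    obtain ⟨A, hA, hAe⟩ := hlocal _ (hnome Δ (WithBot.coe_le_coe.2 (le_of_lt hΔ)))
    exact analyticAt_real_of_local (p := fun t j => phase t (sol t j)) hΔ₀ hΔ hA hAe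
  · have ht := hnome Δ hΔ
    refine iSup₂_le fun α hα => ENNReal.ofReal_le_ofReal ?_
    obtain ⟨hmem, hz, hsym⟩ := hsol _ ht
    rw [mul_sub, dens_eq_mul_rho hΔ₀ hΔ hα, deriv_kMap hΔ₀ hΔ, kMap_eq_phase]
    exact abs_mul_stepRho_sub_dens_le hN hn ht.1 (ht.2.trans_lt ht₀) hm hb0 hz hsym
      (hslope _ ht _ hmem) (hdens _ ht _ hmem) (hL _ ht.1 ht.2) (hB _ ht.1 ht.2)
      (le_poisson ht.1 ht.2 ht₀) (hD _ ht.1 ht.2) hα
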